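/- Let $d\ge 1$ and let $\partial\mathbb B_d=\{z\in\mathbb C^d:\|z\|=1\}$ be the Euclidean unit sphere. Let $\mu$ be a nonzero finite positive Borel measure on $\partial\mathbb B_d$ that is Reinhardt, i.e. invariant under $(z_1,\dots,z_d)\mapsto(t_1z_1,\dots,t_dz_d)$ for all $t\in\mathbb T^d$. Let $\mathcal H^2(\mu)$ be the closure of the polynomials in $z_1,\dots,z_d$ in $L^2(\partial\mathbb B_d,\mu)$, and let $\mathscr M_z=(\mathscr M_{z_1},\dots,\mathscr M_{z_d})$ be the $d$-tuple of operators of multiplication by the coordinate functions on $\mathcal H^2(\mu)$ (these are bounded, since $|z_j|\le 1$ on $\partial\mathbb B_d$). Let $\mathcal U(d)$ be the group of $d\times d$ unitary matrices, acting on $\partial\mathbb B_d$ by $z\mapsto u\cdot z$ and on $d$-tuples of operators by $(u\cdot T)_j=\sum_{k=1}^d u_{jk}T_k$. Write $\mu\circ u^{-1}$ for the measure $\Delta\mapsto\mu(u^{-1}\Delta)$. The Szegő shift is the tuple of multiplications by the coordinate functions on $\mathcal H^2(\sigma)$, where $\sigma$ is the normalized surface area measure on $\partial\mathbb B_d$.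 Then the following statements are equivalent: (i) $\mathscr M_z$ is weakly $\mathcal U(d)$-homogeneous: $\mathscr M_z$ is a commuting tuple and for every $u\in\mathcal U(d)$ there is a bounded invertible operator $\Gamma(u)$ on $\mathcal H^2(\mu)$ with $\Gamma(u)\mathscr M_{z_j}=(u\cdot\mathscr M_z)_j\,\Gamma(u)$ for $j=1,\dots,d$. (ii) There are positive constants $k$ and $K$ such that for every $u\in\mathcal U(d)$ the measure $\mu\circ u^{-1}$ is absolutely continuous with respect to $\mu$ and $$k\le \frac{d(\mu\circ u^{-1})}{d\mu}(z)\le K\qquad\text{for }\mu\text{-almost every }z\in\partial\mathbb B_d.$$ (iii) $\mathscr M_z$ is similar to the Szegő shift: there is a bounded invertible operator $X:\mathcal H^2(\mu)\to\mathcal H^2(\sigma)$ with $X\mathscr M_{z_j}=\mathscr M_{z_j}X$ for $j=1,\dots,d$, where $\mathscr M_{z_j}$ on the right acts on $\mathcal H^2(\sigma)$. -/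

import Mathlib

open MeasureTheory
open scoped ENNReal

noncomputable section

namespace SphereShift

/-! ## The unit sphere of `ℂ^d` and the group actions on it -/

/-- The unit sphere `∂𝔹_d` of `ℂ^d` (Euclidean norm), with its Borel `σ`-algebra. -/
abbrev CSphere (d : ℕ) : Type := Metric.sphere (0 : EuclideanSpace ℂ (Fin d)) 1

theorem norm_toLp_unitary_mulVec {d : ℕ} (u : Matrix.unitaryGroup (Fin d) ℂ)
    (z : EuclideanSpace ℂ (Fin d)) :
    ‖WithLp.toLp 2 (Matrix.mulVec (u : Matrix (Fin d) (Fin d) ℂ) z.ofLp)‖ = ‖z‖ := by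
  have h : ∀ w : EuclideanSpace ℂ (Fin d), ((‖w‖ ^ 2 : ℝ) : ℂ) = star w.ofLp ⬝ᵥ w.ofLp := by
    intro w
    rw [EuclideanSpace.norm_sq_eq]
    simp [dotProduct, Complex.conj_mul']
  have h2 : ((‖WithLp.toLp 2 (Matrix.mulVec (u : Matrix (Fin d) (Fin d) ℂ) z.ofLp)‖ ^ 2 : ℝ) : ℂ)
      = ((‖z‖ ^ 2 : ℝ) : ℂ) := by
    rw [h, h]
    simp only [Matrix.star_mulVec, Matrix.dotProduct_mulVec, Matrix.vecMul_vecMul]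
    rw [← Matrix.star_eq_conjTranspose, Matrix.mem_unitaryGroup_iff'.1 u.2, Matrix.vecMul_one]
  have h3 := Complex.ofReal_injective h2
  exact (sq_eq_sq₀ (norm_nonneg _) (norm_nonneg _)).1 h3

/-- The action `z ↦ u · z` (matrix times column vector) of the unitary group on the sphere. -/
def unitaryAct {d : ℕ} (u : Matrix.unitaryGroup (Fin d) ℂ) (z : CSphere d) : CSphere d :=
  ⟨WithLp.toLp 2 (Matrix.mulVec (u : Matrix (Fin d) (Fin d) ℂ) z.1.ofLp), by
    rw [mem_sphere_zero_iff_norm, norm_toLp_unitary_mulVec]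
    exact mem_sphere_zero_iff_norm.1 z.2⟩

/-- The action `(t, z) ↦ (t₁ z₁, …, t_d z_d)` of the torus `𝕋^d` on the sphere. -/
def torusAct {d : ℕ} (t : Fin d → Circle) (z : CSphere d) : CSphere d :=
  ⟨WithLp.toLp 2 (fun i => (t i : ℂ) * z.1 i), by
    have hz := mem_sphere_zero_iff_norm.1 z.2
    rw [mem_sphere_zero_iff_norm]
    refine Eq.trans ?_ hz
    have ht : ∀ i, ‖(t i : ℂ)‖ = 1 := fun i => Circle.norm_coe (t i)
    simp only [EuclideanSpace.norm_eq, norm_mul, ht, one_mul]⟩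

/-- A measure on the sphere is Reinhardt if it is invariant under the torus action. -/
def IsReinhardt {d : ℕ} (μ : Measure (CSphere d)) : Prop :=
  ∀ t : Fin d → Circle, μ.map (torusAct t) = μ

/-- The normalized surface area measure `σ` on the sphere. -/
def surfaceMeasure (d : ℕ) : Measure (CSphere d) :=
  ProbabilityTheory.cond (volume : Measure (EuclideanSpace ℂ (Fin d))).toSphere Set.univ

instance instIsFiniteMeasureSurfaceMeasure (d : ℕ) : IsFiniteMeasure (surfaceMeasure d) := by
  unfold surfaceMeasure
  infer_instance

/-! ## The space `H²(μ)` and the multiplication tuple -/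

/-- The coordinate function `z ↦ z_j` on the sphere. -/
def coordFun {d : ℕ} (j : Fin d) : C(CSphere d, ℂ) where
  toFun z := z.1 j
  continuous_toFun := by fun_prop

theorem norm_coordFun_le {d : ℕ} (j : Fin d) (z : CSphere d) : ‖coordFun j z‖ ≤ 1 := by
  have h := PiLp.norm_apply_le z.1 j
  rwa [mem_sphere_zero_iff_norm.1 z.2] at h

/-- A polynomial in `z₁, …, z_d`, as a continuous function on the sphere. -/
def polyFun (d : ℕ) : MvPolynomial (Fin d) ℂ →ₐ[ℂ] C(CSphere d, ℂ) :=
  MvPolynomial.aeval coordFun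

/-- A polynomial in `z₁, …, z_d`, as an element of `L²(∂𝔹_d, μ)`. -/
def polyL2 {d : ℕ} (μ : Measure (CSphere d)) [IsFiniteMeasure μ] :
    MvPolynomial (Fin d) ℂ →ₗ[ℂ] Lp ℂ 2 μ :=
  (ContinuousMap.toLp 2 μ ℂ).toLinearMap ∘ₗ (polyFun d).toLinearMap

/-- `H²(μ)`: the closure of the polynomials in `L²(∂𝔹_d, μ)`. -/
def H2 {d : ℕ} (μ : Measure (CSphere d)) [IsFiniteMeasure μ] : Submodule ℂ (Lp ℂ 2 μ) :=
  (LinearMap.range (polyL2 μ)).topologicalClosure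

theorem memLp_coord_mul {d : ℕ} (μ : Measure (CSphere d)) (j : Fin d) (f : Lp ℂ 2 μ) :
    MemLp (fun z => coordFun j z * f z) 2 μ := by
  refine (Lp.memLp f).of_le_mul (c := 1)
    ((coordFun j).continuous.aestronglyMeasurable.mul (Lp.aestronglyMeasurable f)) ?_
  filter_upwards with z
  rw [norm_mul]
  exact mul_le_mul_of_nonneg_right (norm_coordFun_le j z) (norm_nonneg _)

/-- Multiplication by the coordinate function `z_j` on `L²(∂𝔹_d, μ)`. -/
def mulL2 {d : ℕ} (μ : Measure (CSphere d)) (j : Fin d) : Lp ℂ 2 μ →L[ℂ] Lp ℂ 2 μ :=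
  LinearMap.mkContinuous
    { toFun := fun f => (memLp_coord_mul μ j f).toLp _
      map_add' := fun f g => by
        rw [← MemLp.toLp_add]
        refine MemLp.toLp_congr _ _ ?_
        filter_upwards [Lp.coeFn_add f g] with z hz
        rw [hz]
        exact mul_add _ _ _
      map_smul' := fun c f => by
        rw [RingHom.id_apply, ← MemLp.toLp_const_smul]
        refine MemLp.toLp_congr _ _ ?_
        filter_upwards [Lp.coeFn_smul c f] with z hz
        rw [hz]
        exact mul_left_comm _ _ _ } 1 (fun f => by
      refine Lp.norm_le_mul_norm_of_ae_le_mul ?_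
      filter_upwards [(memLp_coord_mul μ j f).coeFn_toLp] with z hz
      simp only [LinearMap.coe_mk, AddHom.coe_mk, hz, norm_mul]
      exact mul_le_mul_of_nonneg_right (norm_coordFun_le j z) (norm_nonneg _))

theorem coeFn_mulL2 {d : ℕ} (μ : Measure (CSphere d)) (j : Fin d) (f : Lp ℂ 2 μ) :
    mulL2 μ j f =ᵐ[μ] fun z => z.1 j * f z :=
  (memLp_coord_mul μ j f).coeFn_toLp

theorem mulL2_polyL2 {d : ℕ} (μ : Measure (CSphere d)) [IsFiniteMeasure μ] (j : Fin d)
    (p : MvPolynomial (Fin d) ℂ) :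
    mulL2 μ j (polyL2 μ p) = polyL2 μ (MvPolynomial.X j * p) := by
  refine Lp.ext ?_
  have h1 := ContinuousMap.coeFn_toLp (p := 2) (𝕜 := ℂ) μ (polyFun d p)
  have h2 := ContinuousMap.coeFn_toLp (p := 2) (𝕜 := ℂ) μ (polyFun d (MvPolynomial.X j * p))
  filter_upwards [coeFn_mulL2 μ j (polyL2 μ p), h1, h2] with z hz h1 h2
  rw [hz]
  refine Eq.trans ?_ h2.symm
  refine (congrArg (fun w => z.1 j * w) h1).trans ?_
  simp [polyFun, coordFun]

theorem mulL2_mem_H2 {d : ℕ} (μ : Measure (CSphere d)) [IsFiniteMeasure μ] (j : Fin d) :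
    ∀ f ∈ H2 μ, mulL2 μ j f ∈ H2 μ := by
  intro f hf
  refine map_mem_closure (mulL2 μ j).continuous hf ?_
  rintro _ ⟨p, rfl⟩
  exact ⟨MvPolynomial.X j * p, (mulL2_polyL2 μ j p).symm⟩

/-- The tuple `M_z = (M_{z₁}, …, M_{z_d})` of multiplications by the coordinate functions
on `H²(μ)`. -/
def Mz {d : ℕ} (μ : Measure (CSphere d)) [IsFiniteMeasure μ] (j : Fin d) : H2 μ →L[ℂ] H2 μ :=
  (mulL2 μ j).restrict (mulL2_mem_H2 μ j)

/-- The Szegő shift: the multiplication tuple on `H²(σ)`, the Hardy space of the ball realized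
on the sphere through boundary values. -/
def szegoShift (d : ℕ) (j : Fin d) : H2 (surfaceMeasure d) →L[ℂ] H2 (surfaceMeasure d) :=
  Mz (surfaceMeasure d) j

/-! ## Operator tuples -/

/-- `(u · T)_j = ∑ₖ u_{jk} T_k`. -/
def unitaryActTuple {d : ℕ} {H : Type*} [NormedAddCommGroup H] [NormedSpace ℂ H]
    (u : Matrix.unitaryGroup (Fin d) ℂ) (T : Fin d → H →L[ℂ] H) (j : Fin d) : H →L[ℂ] H :=
  ∑ k, (u : Matrix (Fin d) (Fin d) ℂ) j k • T k

/-- Two tuples are similar if some bounded invertible operator intertwines them. -/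
def SimilarTuples {d : ℕ} {H K : Type*} [NormedAddCommGroup H] [NormedSpace ℂ H]
    [NormedAddCommGroup K] [NormedSpace ℂ K]
    (T : Fin d → H →L[ℂ] H) (S : Fin d → K →L[ℂ] K) : Prop :=
  ∃ X : H ≃L[ℂ] K, ∀ j, (X : H →L[ℂ] K) ∘L T j = S j ∘L (X : H →L[ℂ] K)

/-- A commuting tuple `T` is weakly `𝒰(d)`-homogeneous if for every unitary `u` there is a bounded
invertible `Γ` with `Γ T_j = (u · T)_j Γ` for all `j`. -/
def IsWeaklyUnitaryHomogeneous {d : ℕ} {H : Type*} [NormedAddCommGroup H] [NormedSpace ℂ H]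
    (T : Fin d → H →L[ℂ] H) : Prop :=
  (∀ i j, Commute (T i) (T j)) ∧
    ∀ u : Matrix.unitaryGroup (Fin d) ℂ, SimilarTuples T (unitaryActTuple u T)

end SphereShift

end

/-! The hard direction is (i) ⇒ (ii). An operator `Γ` intertwining `M_z` with `u · M_z` sends `p` to
`(p ∘ u) g`, where `g = Γ 1` (`coeFn_intertwiner_polyH2`). Boundedness of `Γ` then says that the
push-forward of `|g|² μ` under `u` is at most `‖Γ‖² μ` when tested on all `|p|²`. Sums of such
squares form a semiring that is uniformly dense in the nonnegative continuous functions on the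
sphere, so the inequality holds between measures (`measure_le_smul_of_forall_polyFun`).

It remains to remove the weight `|g|²`, which need not be bounded below pointwise. It is bounded
below on average over the circles `{λz : |λ| = 1}`: a rotation invariant `F ≥ 0` cannot distinguish
`g ∈ H²(μ)` from its mean `c`, so expanding `∫ F |g - c|² ≥ 0` gives `∫ F |g|² ≥ |c|² ∫ F`.
Surjectivity of `Γ` forces `c ≠ 0`. Averaging indicators over scalar rotations, which commute with
`u` and preserve `μ`, turns this into `μ ∘ u⁻¹ ≤ (‖Γ‖² / |c|²) μ`
(`IsReinhardt.exists_map_unitaryAct_le`). A Baire category argument on the compact group `𝒰(d)`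
makes the constant uniform (`exists_forall_map_unitaryAct_le`), and the lower bound is the upper
bound for `u⁻¹`.

For (ii) ⇒ (iii), averaging the translates of `μ` over Haar measure produces a multiple of `σ`, so
`μ` and `σ` are comparable (`smul_le_surfaceMeasure_and_le`) and the identity on polynomials extends
to a similarity. For (iii) ⇒ (i), `σ` is unitarily invariant, so `p ↦ p ∘ u` makes the Szegő shift
homogeneous, and this property passes through similarity. -/

namespace SphereShift

/-! ### Comparison of measures by semirings of test functions -/

section Semiring

variable {X : Type*} [TopologicalSpace X]

/-- The functions `f` for which some `c ± f` belong to a given semiring `S` that contains the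
nonnegative constants; they form a subalgebra. -/
def boundedSubalgebra (S : Subsemiring C(X, ℝ))
    (hS : ∀ c : ℝ, 0 ≤ c → ContinuousMap.const X c ∈ S) : Subalgebra ℝ C(X, ℝ) where
  carrier := {f | ∃ c : ℝ, 0 ≤ c ∧
    ContinuousMap.const X c + f ∈ S ∧ ContinuousMap.const X c - f ∈ S}
  add_mem' := by
    rintro f g ⟨c, hc, h1, h2⟩ ⟨c', hc', h1', h2'⟩
    refine ⟨c + c', add_nonneg hc hc', ?_, ?_⟩
    · convert S.add_mem h1 h1' using 1
      ext x; simp; ring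
    · convert S.add_mem h2 h2' using 1
      ext x; simp; ring
  mul_mem' := by
    rintro f g ⟨c, hc, h1, h2⟩ ⟨c', hc', h1', h2'⟩
    -- Both cases come from `2(cc' ± fg) = (c + f)(c' ± g) + (c - f)(c' ∓ g)`.
    have hh : ContinuousMap.const X (1 / 2 : ℝ) ∈ S := hS _ (by norm_num)
    refine ⟨c * c', mul_nonneg hc hc', ?_, ?_⟩
    · convert S.mul_mem hh (S.add_mem (S.mul_mem h1 h1') (S.mul_mem h2 h2')) using 1
      ext x; simp; ring
    · convert S.mul_mem hh (S.add_mem (S.mul_mem h1 h2') (S.mul_mem h2 h1')) using 1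
      ext x; simp; ring
  algebraMap_mem' := by
    intro r
    refine ⟨|r|, abs_nonneg r, ?_, ?_⟩
    · convert hS (|r| + r) (by linarith [neg_abs_le r]) using 1
      ext x; simp
    · convert hS (|r| - r) (by linarith [le_abs_self r]) using 1
      ext x; simp

/-- A nonnegative function `f` with `c ± f ∈ S` is a uniform limit of elements of `S`, by
Bernstein approximation of the positive part. -/
theorem mem_closure_of_mem_boundedSubalgebra {S : Subsemiring C(X, ℝ)}
    (hS : ∀ c : ℝ, 0 ≤ c → ContinuousMap.const X c ∈ S) {f : C(X, ℝ)}
    (hf : f ∈ boundedSubalgebra S hS) (hS0 : ∀ g ∈ S, ∀ x, 0 ≤ g x) (hf0 : ∀ x, 0 ≤ f x) :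
    f ∈ closure (S : Set C(X, ℝ)) := by
  obtain ⟨c₀, hc₀, h1, h2⟩ := hf
  -- Enlarging the constant by 1 makes it positive, so that division by `2c` is possible.
  obtain ⟨c, hc, h1, h2⟩ : ∃ c : ℝ, 0 < c ∧
      ContinuousMap.const X c + f ∈ S ∧ ContinuousMap.const X c - f ∈ S := by
    refine ⟨c₀ + 1, by linarith, ?_, ?_⟩
    · convert S.add_mem h1 (hS 1 zero_le_one) using 1
      ext x; simp; ring
    · convert S.add_mem h2 (hS 1 zero_le_one) using 1
      ext x; simp; ring
  have hb : ∀ x, f x ≤ c := fun x => by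
    have := hS0 _ h2 x
    simpa using this
  let y : C(X, unitInterval) :=
    { toFun := fun x => ⟨(c + f x) / (2 * c), by
        have := hf0 x
        positivity, by
        rw [div_le_one (by linarith)]
        linarith [hb x]⟩
      continuous_toFun := by fun_prop }
  -- `ψ` undoes `y = (c + f) / (2c)` where `f ≥ 0`. Truncation at 0 keeps `ψ ≥ 0` on all of `[0,
  -- 1]`, so its Bernstein coefficients are nonnegative constants, hence in `S`; so are `y` and `1 -
  -- y`.
  let ψ : C(unitInterval, ℝ) := ⟨fun t => c * max (2 * (t : ℝ) - 1) 0, by fun_prop⟩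
  have hy1 : (⟨fun x => (y x : ℝ), by fun_prop⟩ : C(X, ℝ)) ∈ S := by
    convert S.mul_mem (hS (1 / (2 * c)) (by positivity)) h1 using 1
    ext x
    simp [y]
    field_simp
  have hy2 : (⟨fun x => 1 - (y x : ℝ), by fun_prop⟩ : C(X, ℝ)) ∈ S := by
    convert S.mul_mem (hS (1 / (2 * c)) (by positivity)) h2 using 1
    ext x
    simp [y]
    field_simp
    ring
  have hlim : Filter.Tendsto (fun n => (bernsteinApproximation n ψ).comp y) Filter.atTop
      (nhds (ψ.comp y)) :=
    ((ContinuousMap.continuous_precomp y).tendsto ψ).comp (bernsteinApproximation_uniform ψ)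
  have hfe : ψ.comp y = f := by
    ext x
    have h3 := hf0 x
    have h4 : 2 * ((c + f x) / (2 * c)) - 1 = f x / c := by
      field_simp
      ring
    simp only [ψ, y, ContinuousMap.comp_apply, ContinuousMap.coe_mk, h4]
    rw [max_eq_left (by positivity)]
    field_simp
  rw [hfe] at hlim
  refine mem_closure_of_tendsto hlim (Filter.Eventually.of_forall fun n => ?_)
  have : (bernsteinApproximation n ψ).comp y = ∑ k : Fin (n + 1),
      ContinuousMap.const X (ψ (bernstein.z k) * (n.choose k : ℝ)) *
        ((⟨fun x => (y x : ℝ), by fun_prop⟩ : C(X, ℝ)) ^ (k : ℕ) *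
        (⟨fun x => 1 - (y x : ℝ), by fun_prop⟩ : C(X, ℝ)) ^ (n - k : ℕ)) := by
    ext x
    rw [ContinuousMap.comp_apply, bernsteinApproximation.apply]
    simp only [ContinuousMap.coe_sum, Finset.sum_apply, bernstein_apply, smul_eq_mul]
    refine Finset.sum_congr rfl fun k _ => ?_
    simp
    ring
  rw [this]
  refine S.sum_mem fun k _ => S.mul_mem (hS _ ?_) (S.mul_mem (S.pow_mem hy1 _) (S.pow_mem hy2 _))
  exact mul_nonneg (mul_nonneg hc.le (le_max_right _ _)) (Nat.cast_nonneg _)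

/-- A semiring of nonnegative functions that contains the constants is dense in all nonnegative
functions as soon as its bounded elements separate points. -/
theorem mem_closure_of_nonneg [CompactSpace X] {S : Subsemiring C(X, ℝ)}
    (hS : ∀ c : ℝ, 0 ≤ c → ContinuousMap.const X c ∈ S) (hS0 : ∀ g ∈ S, ∀ x, 0 ≤ g x)
    (hsep : (boundedSubalgebra S hS).SeparatesPoints) {f : C(X, ℝ)} (hf0 : ∀ x, 0 ≤ f x) :
    f ∈ closure (S : Set C(X, ℝ)) := by
  rw [← closure_closure, Metric.mem_closure_iff]
  intro ε hε
  obtain ⟨g, hg⟩ := ContinuousMap.exists_mem_subalgebra_near_continuousMap_of_separatesPoints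
    (boundedSubalgebra S hS) hsep f (ε / 2) (by linarith)
  have hgx : ∀ x, |g.1 x - f x| < ε / 2 := fun x =>
    lt_of_le_of_lt ((g.1 - f).norm_coe_le_norm x) hg
  -- Stone–Weierstrass may give a slightly negative `g`; the shift by `ε / 2` restores nonnegativity
  -- at the cost of the other half of `ε`.
  refine ⟨g.1 + algebraMap ℝ C(X, ℝ) (ε / 2), ?_, ?_⟩
  · refine mem_closure_of_mem_boundedSubalgebra hS
      (Subalgebra.add_mem _ g.2 (Subalgebra.algebraMap_mem _ _)) hS0 fun x => ?_
    have := (abs_lt.1 (hgx x)).1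
    have h0 := hf0 x
    have : 0 ≤ g.1 x + ε / 2 := by linarith
    simpa using this
  · rw [ContinuousMap.dist_lt_iff hε]
    intro x
    have h1 := abs_lt.1 (hgx x)
    have h2 : |f x - (g.1 x + ε / 2)| < ε := abs_lt.2 ⟨by linarith, by linarith⟩
    simpa [Real.dist_eq] using h2

end Semiring

/-- Finite measures on a compact pseudometrizable space are compared by testing on nonnegative
continuous functions. -/
theorem measure_le_smul_of_forall_integral_le {X : Type*} [TopologicalSpace X] [CompactSpace X]
    [TopologicalSpace.PseudoMetrizableSpace X] [MeasurableSpace X] [BorelSpace X]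
    {μ ν : Measure X} [IsFiniteMeasure μ] [IsFiniteMeasure ν] {C : ℝ}
    (h : ∀ f : C(X, ℝ), (∀ x, 0 ≤ f x) → ∫ x, f x ∂ν ≤ C * ∫ x, f x ∂μ) :
    ν ≤ ENNReal.ofReal C • μ := by
  let _ := TopologicalSpace.pseudoMetrizableSpacePseudoMetric X
  have hcl : ∀ F : Set X, IsClosed F → ν F ≤ ENNReal.ofReal C * μ F := by
    intro F hF
    have hint : ∀ (ρ : Measure X) [IsFiniteMeasure ρ] (n : ℕ),
        ∫⁻ x, (hF.apprSeq n x : ℝ≥0∞) ∂ρ = ENNReal.ofReal (∫ x, (hF.apprSeq n x : ℝ) ∂ρ) := by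
      intro ρ _ n
      rw [ofReal_integral_eq_lintegral_ofReal]
      · simp
      · refine Continuous.integrable_of_hasCompactSupport (by fun_prop) ?_
        exact HasCompactSupport.of_compactSpace _
      · exact Filter.Eventually.of_forall fun x => NNReal.coe_nonneg _
    refine le_of_tendsto_of_tendsto' (HasOuterApproxClosed.tendsto_lintegral_apprSeq hF ν)
      (ENNReal.Tendsto.const_mul (HasOuterApproxClosed.tendsto_lintegral_apprSeq hF μ) (Or.inr ENNReal.ofReal_ne_top))
      fun n => ?_
    rw [hint, hint, ← ENNReal.ofReal_mul' (integral_nonneg fun x => NNReal.coe_nonneg _)]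
    exact ENNReal.ofReal_le_ofReal (h ⟨fun x => (hF.apprSeq n x : ℝ), by fun_prop⟩
      fun x => NNReal.coe_nonneg _)
  refine Measure.le_iff.2 fun A hA => ?_
  rw [hA.measure_eq_iSup_isClosed_of_ne_top (measure_ne_top ν A)]
  refine iSup₂_le fun F hFA => iSup_le fun hF => (hcl F hF).trans ?_
  rw [Measure.smul_apply, smul_eq_mul]
  gcongr

/-! ### Sums of squared moduli of polynomials -/

variable {d : ℕ}

@[simp]
theorem polyFun_X (j : Fin d) (z : CSphere d) : polyFun d (MvPolynomial.X j) z = z.1 j := by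
  simp [polyFun, coordFun]

@[simp]
theorem polyFun_C (c : ℂ) (z : CSphere d) : polyFun d (MvPolynomial.C c) z = c := by
  simp [polyFun]

theorem sum_normSq_coord (z : CSphere d) : ∑ j, ‖z.1 j‖ ^ 2 = 1 := by
  rw [← EuclideanSpace.norm_sq_eq, mem_sphere_zero_iff_norm.1 z.2, one_pow]

/-- The squared moduli of polynomials on the sphere. -/
def normSqPoly (d : ℕ) : Submonoid C(CSphere d, ℝ) where
  carrier := {f | ∃ p, ∀ z, f z = ‖polyFun d p z‖ ^ 2}
  one_mem' := ⟨1, fun z => by simp⟩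
  mul_mem' := by
    rintro f g ⟨p, hp⟩ ⟨q, hq⟩
    exact ⟨p * q, fun z => by simp [hp, hq, mul_pow]⟩

theorem normSqPoly_closure_nonneg {f : C(CSphere d, ℝ)}
    (hf : f ∈ (normSqPoly d).subsemiringClosure) (z : CSphere d) : 0 ≤ f z := by
  rw [Submonoid.subsemiringClosure_mem] at hf
  induction hf using AddSubmonoid.closure_induction with
  | mem f hf =>
    obtain ⟨p, hp⟩ := hf
    rw [hp]
    positivity
  | zero => simp
  | add f g _ _ h1 h2 => exact add_nonneg h1 h2

theorem const_mem_normSqPoly_closure (c : ℝ) (hc : 0 ≤ c) :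
    ContinuousMap.const (CSphere d) c ∈ (normSqPoly d).subsemiringClosure := by
  rw [Submonoid.subsemiringClosure_mem]
  refine AddSubmonoid.subset_closure ⟨MvPolynomial.C (Real.sqrt c : ℂ), fun z => ?_⟩
  rw [polyFun_C, Complex.norm_real, Real.norm_eq_abs, sq_abs, Real.sq_sqrt hc]
  rfl

/-- Since `∑ |z_k|² = 1` on the sphere, the function equals `|1 + a z_j|² + ∑_{k ≠ j} |z_k|²`. -/
theorem two_add_re_mem_normSqPoly_closure (j : Fin d) {a : ℂ} (ha : ‖a‖ = 1) :
    (⟨fun z => 2 + 2 * (a * coordFun j z).re, by fun_prop⟩ : C(CSphere d, ℝ)) ∈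
      (normSqPoly d).subsemiringClosure := by
  rw [Submonoid.subsemiringClosure_mem]
  have h1 : (⟨fun z => ‖polyFun d (1 + MvPolynomial.C a * MvPolynomial.X j) z‖ ^ 2,
      by fun_prop⟩ : C(CSphere d, ℝ)) ∈ AddSubmonoid.closure (normSqPoly d : Set _) :=
    AddSubmonoid.subset_closure ⟨_, fun z => rfl⟩
  have h2 : ∀ k : Fin d, (⟨fun z => ‖polyFun d (MvPolynomial.X k) z‖ ^ 2,
      by fun_prop⟩ : C(CSphere d, ℝ)) ∈ AddSubmonoid.closure (normSqPoly d : Set _) :=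
    fun k => AddSubmonoid.subset_closure ⟨_, fun z => rfl⟩
  convert add_mem h1 (sum_mem (t := Finset.univ.erase j) fun k _ => h2 k) using 1
  ext z
  have h3 := sum_normSq_coord z
  rw [← Finset.add_sum_erase _ _ (Finset.mem_univ j)] at h3
  have h4 : ‖1 + a * z.1 j‖ ^ 2 = 1 + 2 * (a * z.1 j).re + ‖z.1 j‖ ^ 2 := by
    have h5 : ‖z.1 j‖ ^ 2 = ‖a * z.1 j‖ ^ 2 := by rw [norm_mul, ha, one_mul]
    rw [h5, ← Complex.normSq_eq_norm_sq, ← Complex.normSq_eq_norm_sq, Complex.normSq_add]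
    simp
    ring
  simp only [ContinuousMap.coe_mk, ContinuousMap.add_apply, ContinuousMap.coe_sum,
    Finset.sum_apply, polyFun_X, map_add, map_mul, map_one, ContinuousMap.mul_apply,
    ContinuousMap.one_apply, polyFun_C]
  rw [h4, show coordFun j z = z.1 j from rfl]
  linarith

/-- The real and imaginary parts of the coordinates already separate points; they are `Re (a z_j)`
with `a = 1` and `a = -i`. -/
theorem separatesPoints_boundedSubalgebra_normSqPoly :
    (boundedSubalgebra (normSqPoly d).subsemiringClosure
      const_mem_normSqPoly_closure).SeparatesPoints := by
  intro z w hzw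
  have key : ∀ (j : Fin d) (a : ℂ), ‖a‖ = 1 → (a * z.1 j).re ≠ (a * w.1 j).re →
      ∃ f ∈ (fun f : C(CSphere d, ℝ) => (f : CSphere d → ℝ)) ''
        (boundedSubalgebra (normSqPoly d).subsemiringClosure
          const_mem_normSqPoly_closure : Set C(CSphere d, ℝ)), f z ≠ f w := by
    intro j a ha hne
    refine ⟨_, ⟨(⟨fun z => 2 * (a * coordFun j z).re, by fun_prop⟩ : C(CSphere d, ℝ)),
      ⟨2, by norm_num, ?_, ?_⟩, rfl⟩, ?_⟩
    · convert two_add_re_mem_normSqPoly_closure j ha using 1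
      ext x
      rfl
    · convert two_add_re_mem_normSqPoly_closure j (a := -a) (by rwa [norm_neg]) using 1
      ext x
      simp
      ring
    · intro h
      exact hne (mul_left_cancel₀ two_ne_zero h)
  obtain ⟨j, hj⟩ : ∃ j, z.1 j ≠ w.1 j := by
    by_contra! h
    exact hzw (Subtype.ext (PiLp.ext h))
  by_cases hre : (z.1 j).re = (w.1 j).re
  · refine key j (-Complex.I) (by simp) fun h => hj (Complex.ext hre ?_)
    simpa using h
  · exact key j 1 (by simp) (by simpa using hre)

/-- Finite measures on the sphere are compared by testing on squared moduli of polynomials. -/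
theorem measure_le_smul_of_forall_polyFun {μ ν : Measure (CSphere d)} [IsFiniteMeasure μ]
    [IsFiniteMeasure ν] {C : ℝ}
    (h : ∀ p, ∫ z, ‖polyFun d p z‖ ^ 2 ∂ν ≤ C * ∫ z, ‖polyFun d p z‖ ^ 2 ∂μ) :
    ν ≤ ENNReal.ofReal C • μ := by
  refine measure_le_smul_of_forall_integral_le fun f hf => ?_
  have hint : ∀ (ρ : Measure (CSphere d)) [IsFiniteMeasure ρ] (f : C(CSphere d, ℝ)),
      Integrable f ρ := fun ρ _ f =>
    f.continuous.integrable_of_hasCompactSupport (HasCompactSupport.of_compactSpace _)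
  have hcont : ∀ (ρ : Measure (CSphere d)) [IsFiniteMeasure ρ],
      Continuous fun f : C(CSphere d, ℝ) => ∫ z, f z ∂ρ := by
    intro ρ _
    have : (fun f : C(CSphere d, ℝ) => ∫ z, f z ∂ρ) =
        fun f => ∫ z, ContinuousMap.toLp 1 ρ ℝ f z ∂ρ := by
      ext f
      exact integral_congr_ae (ContinuousMap.coeFn_toLp ρ f).symm
    rw [this]
    exact continuous_integral.comp (ContinuousMap.toLp 1 ρ ℝ).continuous
  have hf' := mem_closure_of_nonneg const_mem_normSqPoly_closure
    (fun g hg => normSqPoly_closure_nonneg hg) separatesPoints_boundedSubalgebra_normSqPoly hf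
  refine closure_minimal (t := {f : C(CSphere d, ℝ) | ∫ z, f z ∂ν ≤ C * ∫ z, f z ∂μ}) ?_
    (isClosed_le (hcont ν) (continuous_const.mul (hcont μ))) hf'
  intro g hg
  rw [SetLike.mem_coe, Submonoid.subsemiringClosure_mem] at hg
  induction hg using AddSubmonoid.closure_induction with
  | mem f hf =>
    obtain ⟨p, hp⟩ := hf
    simpa only [Set.mem_ofPred_eq, hp] using h p
  | zero => simp
  | add f g _ _ h1 h2 =>
    simp only [Set.mem_ofPred_eq, ContinuousMap.add_apply] at h1 h2 ⊢
    rw [integral_add (hint ν f) (hint ν g), integral_add (hint μ f) (hint μ g)]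
    linarith

/-! ### The action of the unitary group -/

theorem continuous_unitaryAct :
    Continuous fun x : Matrix.unitaryGroup (Fin d) ℂ × CSphere d => unitaryAct x.1 x.2 := by
  refine Continuous.subtype_mk ((PiLp.continuous_toLp 2 _).comp ?_) _
  exact (continuous_subtype_val.comp continuous_fst).matrix_mulVec
    ((PiLp.continuous_ofLp 2 _).comp (continuous_subtype_val.comp continuous_snd))

@[fun_prop]
theorem continuous_unitaryAct_right (u : Matrix.unitaryGroup (Fin d) ℂ) :
    Continuous (unitaryAct u) :=
  continuous_unitaryAct.comp (Continuous.prodMk_right u)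

@[fun_prop]
theorem measurable_unitaryAct (u : Matrix.unitaryGroup (Fin d) ℂ) :
    Measurable (unitaryAct u) :=
  (continuous_unitaryAct_right u).measurable

theorem unitaryAct_mul (u v : Matrix.unitaryGroup (Fin d) ℂ) (z : CSphere d) :
    unitaryAct (u * v) z = unitaryAct u (unitaryAct v z) := by
  simp [unitaryAct]

@[simp]
theorem unitaryAct_one (z : CSphere d) : unitaryAct 1 z = z := by
  simp [unitaryAct]

@[simp]
theorem unitaryAct_inv_unitaryAct (u : Matrix.unitaryGroup (Fin d) ℂ) (z : CSphere d) :
    unitaryAct u⁻¹ (unitaryAct u z) = z := by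
  rw [← unitaryAct_mul, inv_mul_cancel, unitaryAct_one]

theorem map_unitaryAct_mul (μ : Measure (CSphere d)) (u v : Matrix.unitaryGroup (Fin d) ℂ) :
    μ.map (unitaryAct (u * v)) = (μ.map (unitaryAct v)).map (unitaryAct u) := by
  rw [Measure.map_map (measurable_unitaryAct u) (measurable_unitaryAct v)]
  congr 1
  ext1 z
  exact unitaryAct_mul u v z

@[simp]
theorem map_unitaryAct_one (μ : Measure (CSphere d)) : μ.map (unitaryAct 1) = μ := by
  have : unitaryAct (1 : Matrix.unitaryGroup (Fin d) ℂ) = id := by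
    ext1 z
    simp
  rw [this, Measure.map_id]

theorem unitaryAct_apply (u : Matrix.unitaryGroup (Fin d) ℂ) (z : CSphere d) (j : Fin d) :
    (unitaryAct u z).1 j = ∑ k, (u : Matrix (Fin d) (Fin d) ℂ) j k * z.1 k := rfl

/-- The linear change of variables `p ↦ p(u z)` on polynomials. -/
noncomputable def polySubst (u : Matrix.unitaryGroup (Fin d) ℂ) :
    MvPolynomial (Fin d) ℂ →ₐ[ℂ] MvPolynomial (Fin d) ℂ :=
  MvPolynomial.aeval fun j =>
    ∑ k, MvPolynomial.C ((u : Matrix (Fin d) (Fin d) ℂ) j k) * MvPolynomial.X k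

theorem polyFun_polySubst (u : Matrix.unitaryGroup (Fin d) ℂ) (p : MvPolynomial (Fin d) ℂ)
    (z : CSphere d) : polyFun d (polySubst u p) z = polyFun d p (unitaryAct u z) := by
  induction p using MvPolynomial.induction_on with
  | C a => simp [polySubst, MvPolynomial.algebraMap_eq]
  | add p q hp hq => simp [hp, hq]
  | mul_X p j hp =>
    simp only [map_mul, ContinuousMap.mul_apply, hp, polyFun_X, unitaryAct_apply]
    simp [polySubst]

/-! ### Norms in `L²` -/

theorem norm_sq_eq_integral {α : Type*} [MeasurableSpace α] {μ : Measure α} (f : Lp ℂ 2 μ) :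
    ‖f‖ ^ 2 = ∫ z, ‖f z‖ ^ 2 ∂μ := by
  have h := @inner_self_eq_norm_sq ℂ (Lp ℂ 2 μ) _ _ _ f
  rw [← h, L2.inner_def, ← integral_re (L2.integrable_inner f f)]
  refine integral_congr_ae (Filter.Eventually.of_forall fun z => ?_)
  exact inner_self_eq_norm_sq (𝕜 := ℂ) (f z)

theorem coeFn_polyL2 (μ : Measure (CSphere d)) [IsFiniteMeasure μ] (p : MvPolynomial (Fin d) ℂ) :
    polyL2 μ p =ᵐ[μ] polyFun d p :=
  ContinuousMap.coeFn_toLp (p := 2) (𝕜 := ℂ) μ (polyFun d p)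

theorem norm_sq_polyL2 (μ : Measure (CSphere d)) [IsFiniteMeasure μ]
    (p : MvPolynomial (Fin d) ℂ) : ‖polyL2 μ p‖ ^ 2 = ∫ z, ‖polyFun d p z‖ ^ 2 ∂μ := by
  rw [norm_sq_eq_integral]
  refine integral_congr_ae ?_
  filter_upwards [coeFn_polyL2 μ p] with z hz
  rw [hz]

/-! ### Polynomials in `H²(μ)` -/

/-- A polynomial as an element of `H²(μ)`. -/
noncomputable def polyH2 (μ : Measure (CSphere d)) [IsFiniteMeasure μ] :
    MvPolynomial (Fin d) ℂ →ₗ[ℂ] H2 μ :=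
  (polyL2 μ).codRestrict (H2 μ) fun p => subset_closure ⟨p, rfl⟩

@[simp]
theorem coe_polyH2 (μ : Measure (CSphere d)) [IsFiniteMeasure μ] (p : MvPolynomial (Fin d) ℂ) :
    (polyH2 μ p : Lp ℂ 2 μ) = polyL2 μ p := rfl

theorem denseRange_polyH2 (μ : Measure (CSphere d)) [IsFiniteMeasure μ] :
    DenseRange (polyH2 μ) := by
  intro f
  rw [closure_subtype]
  convert (show (f : Lp ℂ 2 μ) ∈ closure (LinearMap.range (polyL2 μ) : Set (Lp ℂ 2 μ)) from f.2)
    using 2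
  ext g
  simp

theorem Mz_polyH2 (μ : Measure (CSphere d)) [IsFiniteMeasure μ] (j : Fin d)
    (p : MvPolynomial (Fin d) ℂ) : Mz μ j (polyH2 μ p) = polyH2 μ (MvPolynomial.X j * p) :=
  Subtype.ext (mulL2_polyL2 μ j p)

theorem coeFn_unitaryActTuple_Mz (μ : Measure (CSphere d)) [IsFiniteMeasure μ]
    (u : Matrix.unitaryGroup (Fin d) ℂ) (j : Fin d) (f : H2 μ) :
    (unitaryActTuple u (Mz μ) j f : Lp ℂ 2 μ) =ᵐ[μ]
      fun z => (unitaryAct u z).1 j * (f : Lp ℂ 2 μ) z := by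
  have h : (unitaryActTuple u (Mz μ) j f : Lp ℂ 2 μ) =
      ∑ k, (u : Matrix (Fin d) (Fin d) ℂ) j k • mulL2 μ k f := by
    simp [unitaryActTuple, Mz]
  rw [h]
  have h2 := Lp.coeFn_fun_finsetSum Finset.univ
    fun k => (u : Matrix (Fin d) (Fin d) ℂ) j k • mulL2 μ k f
  have h3 : ∀ k, ((u : Matrix (Fin d) (Fin d) ℂ) j k • mulL2 μ k f : Lp ℂ 2 μ) =ᵐ[μ]
      fun z => (u : Matrix (Fin d) (Fin d) ℂ) j k * (z.1 k * (f : Lp ℂ 2 μ) z) := by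
    intro k
    filter_upwards [Lp.coeFn_smul ((u : Matrix (Fin d) (Fin d) ℂ) j k) (mulL2 μ k f),
      coeFn_mulL2 μ k f] with z hz1 hz2
    rw [hz1, Pi.smul_apply, hz2, smul_eq_mul]
  filter_upwards [h2, ae_all_iff.2 h3] with z hz1 hz2
  rw [hz1, unitaryAct_apply, Finset.sum_mul]
  exact Finset.sum_congr rfl fun k _ => by rw [hz2, mul_assoc]

theorem unitaryActTuple_Mz_polyH2 (μ : Measure (CSphere d)) [IsFiniteMeasure μ]
    (u : Matrix.unitaryGroup (Fin d) ℂ) (j : Fin d) (p : MvPolynomial (Fin d) ℂ) :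
    unitaryActTuple u (Mz μ) j (polyH2 μ p) = polyH2 μ (polySubst u (MvPolynomial.X j) * p) := by
  simp only [unitaryActTuple, sum_apply, smul_apply,
    Mz_polyH2, ← map_smul, ← map_sum]
  congr 1
  simp [polySubst, Finset.sum_mul, MvPolynomial.smul_eq_C_mul, mul_assoc]

/-- An operator intertwining `M_z` with `u · M_z` is a weighted composition operator. -/
theorem coeFn_intertwiner_polyH2 {μ : Measure (CSphere d)} [IsFiniteMeasure μ]
    {u : Matrix.unitaryGroup (Fin d) ℂ} {Γ : H2 μ →L[ℂ] H2 μ}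
    (hΓ : ∀ j, Γ ∘L Mz μ j = unitaryActTuple u (Mz μ) j ∘L Γ) (p : MvPolynomial (Fin d) ℂ) :
    (Γ (polyH2 μ p) : Lp ℂ 2 μ) =ᵐ[μ]
      fun z => polyFun d p (unitaryAct u z) * (Γ (polyH2 μ 1) : Lp ℂ 2 μ) z := by
  induction p using MvPolynomial.induction_on with
  | C a =>
    have h : polyH2 μ (MvPolynomial.C a) = a • polyH2 μ 1 := by
      rw [← map_smul, MvPolynomial.smul_eq_C_mul, mul_one]
    rw [h, map_smul]
    filter_upwards [Lp.coeFn_smul a (Γ (polyH2 μ 1) : Lp ℂ 2 μ)] with z hz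
    rw [Submodule.coe_smul, hz, polyFun_C, Pi.smul_apply, smul_eq_mul]
  | add p q hp hq =>
    rw [map_add, map_add]
    filter_upwards [Lp.coeFn_add (Γ (polyH2 μ p) : Lp ℂ 2 μ) (Γ (polyH2 μ q)), hp, hq]
      with z hz h1 h2
    rw [Submodule.coe_add, hz, Pi.add_apply, h1, h2, map_add, ContinuousMap.add_apply, add_mul]
  | mul_X p j hp =>
    have h : Γ (polyH2 μ (p * MvPolynomial.X j)) =
        unitaryActTuple u (Mz μ) j (Γ (polyH2 μ p)) := by
      rw [mul_comm, ← Mz_polyH2]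
      exact DFunLike.congr_fun (hΓ j) _
    rw [h]
    filter_upwards [coeFn_unitaryActTuple_Mz μ u j (Γ (polyH2 μ p)), hp] with z h1 h2
    rw [h1, h2, map_mul, ContinuousMap.mul_apply, polyFun_X]
    ring

/-! ### Rotations by scalars -/

/-- The rotation `z ↦ e^{2πit} z` of the sphere. -/
noncomputable def rotate (t : UnitAddCircle) (z : CSphere d) : CSphere d :=
  torusAct (fun _ => AddCircle.toCircle t) z

theorem rotate_apply (t : UnitAddCircle) (z : CSphere d) (j : Fin d) :
    (rotate t z).1 j = (AddCircle.toCircle t : ℂ) * z.1 j := rfl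

theorem continuous_rotate : Continuous fun x : UnitAddCircle × CSphere d => rotate x.1 x.2 := by
  refine Continuous.subtype_mk ((PiLp.continuous_toLp 2 _).comp (continuous_pi fun j => ?_)) _
  have h : Continuous fun x : UnitAddCircle × CSphere d => (AddCircle.toCircle x.1 : ℂ) :=
    continuous_subtype_val.comp (AddCircle.continuous_toCircle.comp continuous_fst)
  exact h.mul (by fun_prop)

theorem continuous_rotate_right (t : UnitAddCircle) : Continuous (rotate t : CSphere d → _) :=
  continuous_rotate.comp (Continuous.prodMk_right t)

theorem rotate_add (s t : UnitAddCircle) (z : CSphere d) :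
    rotate (s + t) z = rotate s (rotate t z) := by
  refine Subtype.ext (PiLp.ext fun j => ?_)
  simp only [rotate_apply, AddCircle.toCircle_add, Circle.coe_mul, mul_assoc]

theorem unitaryAct_rotate (u : Matrix.unitaryGroup (Fin d) ℂ) (t : UnitAddCircle)
    (z : CSphere d) : unitaryAct u (rotate t z) = rotate t (unitaryAct u z) := by
  refine Subtype.ext (PiLp.ext fun j => ?_)
  simp only [rotate_apply, unitaryAct_apply, Finset.mul_sum]
  exact Finset.sum_congr rfl fun k _ => by ring

theorem IsReinhardt.measurePreserving_rotate {μ : Measure (CSphere d)} (hμ : IsReinhardt μ)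
    (t : UnitAddCircle) : MeasurePreserving (rotate t) μ μ :=
  ⟨(continuous_rotate_right t).measurable, hμ _⟩

theorem polyFun_monomial_rotate (s : Fin d →₀ ℕ) (a : ℂ) (t : UnitAddCircle) (z : CSphere d) :
    polyFun d (MvPolynomial.monomial s a) (rotate t z) =
      (AddCircle.toCircle t : ℂ) ^ s.degree * polyFun d (MvPolynomial.monomial s a) z := by
  simp only [MvPolynomial.monomial_eq, map_mul, ContinuousMap.mul_apply, polyFun_C,
    Finsupp.prod, map_prod, map_pow, ContinuousMap.coe_prod, Finset.prod_apply,
    ContinuousMap.coe_pow, Pi.pow_apply, polyFun_X, rotate_apply, mul_pow, Finset.prod_mul_distrib,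
    Finset.prod_pow_eq_pow_sum, Finsupp.degree_apply]
  ring

theorem exists_toCircle_pow_ne_one {n : ℕ} (hn : n ≠ 0) :
    ∃ t : UnitAddCircle, (AddCircle.toCircle t : ℂ) ^ n ≠ 1 := by
  -- With `t = 1 / (2n)` the power is `e^{πi} = -1`.
  refine ⟨((1 / (2 * n) : ℝ) : UnitAddCircle), ?_⟩
  have h : AddCircle.toCircle ((1 / (2 * n) : ℝ) : UnitAddCircle) ^ n = Circle.exp Real.pi := by
    rw [← AddCircle.toCircle_nsmul, ← AddCircle.coe_nsmul, AddCircle.toCircle_apply_mk]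
    congr 1
    have : (n : ℝ) ≠ 0 := Nat.cast_ne_zero.2 hn
    simp
    field_simp
  rw [← Circle.coe_pow, h, Circle.coe_exp, Complex.exp_pi_mul_I]
  norm_num

/-- Against a rotation invariant weight, a polynomial integrates like its constant term. -/
theorem IsReinhardt.integral_mul_polyFun {μ : Measure (CSphere d)} [IsFiniteMeasure μ]
    (hμ : IsReinhardt μ) {F : CSphere d → ℂ} (hF : ∀ t z, F (rotate t z) = F z)
    (hFi : Integrable F μ) (p : MvPolynomial (Fin d) ℂ) :
    ∫ z, F z * polyFun d p z ∂μ = (∫ z, F z ∂μ) * MvPolynomial.constantCoeff p := by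
  induction p using MvPolynomial.induction_on' with
  | monomial s a =>
    rcases eq_or_ne s 0 with rfl | hs
    · have : MvPolynomial.monomial (0 : Fin d →₀ ℕ) a = MvPolynomial.C a := rfl
      simp [this, integral_mul_const]
    · have hdeg : s.degree ≠ 0 := fun h => hs ((Finsupp.degree_eq_zero_iff s).1 h)
      obtain ⟨t, ht⟩ := exists_toCircle_pow_ne_one hdeg
      -- Rotation multiplies a monomial of degree `n` by `λⁿ` and fixes `F` and `μ`, so the integral
      -- equals `λⁿ` times itself, with `λⁿ ≠ 1`.
      have h1 : ∫ z, F z * polyFun d (MvPolynomial.monomial s a) z ∂μ =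
          (AddCircle.toCircle t : ℂ) ^ s.degree *
            ∫ z, F z * polyFun d (MvPolynomial.monomial s a) z ∂μ := by
        rw [← integral_const_mul]
        refine Eq.trans (b := ∫ z, F (rotate t z) *
          polyFun d (MvPolynomial.monomial s a) (rotate t z) ∂μ) ?_ ?_
        · have h2 := hμ.measurePreserving_rotate t
          nth_rw 1 [← h2.map_eq]
          refine integral_map h2.measurable.aemeasurable ?_
          rw [h2.map_eq]
          exact hFi.aestronglyMeasurable.mul (polyFun d _).continuous.aestronglyMeasurable
        · refine integral_congr_ae (Filter.Eventually.of_forall fun z => ?_)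
          simp only [hF, polyFun_monomial_rotate]
          ring
      have h3 : (1 - (AddCircle.toCircle t : ℂ) ^ s.degree) *
          ∫ z, F z * polyFun d (MvPolynomial.monomial s a) z ∂μ = 0 := by
        rw [sub_mul, one_mul, ← h1, sub_self]
      rw [(mul_eq_zero.1 h3).resolve_left (sub_ne_zero.2 ht.symm)]
      simp [MvPolynomial.constantCoeff_monomial, hs]
  | add p q hp hq =>
    have hb : ∀ r : MvPolynomial (Fin d) ℂ, Integrable (fun z => F z * polyFun d r z) μ := fun r =>
      hFi.mul_bdd (c := ‖polyFun d r‖) (polyFun d r).continuous.aestronglyMeasurable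
        (Filter.Eventually.of_forall fun z => (polyFun d r).norm_coe_le_norm z)
    simp only [map_add, ContinuousMap.add_apply, mul_add]
    rw [integral_add (hb p) (hb q), hp, hq]

/-! ### Means of functions in `H²(μ)`. -/

theorem continuous_integral_mul_Lp {α : Type*} [MeasurableSpace α] {μ : Measure α}
    [IsFiniteMeasure μ] {φ : α → ℂ} (hφ : AEStronglyMeasurable φ μ) {c : ℝ}
    (hc : ∀ᵐ z ∂μ, ‖φ z‖ ≤ c) : Continuous fun f : Lp ℂ 2 μ => ∫ z, φ z * f z ∂μ := by
  have hm : MemLp (fun z => (starRingEnd ℂ) (φ z)) 2 μ := by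
    refine MemLp.of_bound (Complex.continuous_conj.comp_aestronglyMeasurable hφ) c ?_
    simpa using hc
  have h : (fun f : Lp ℂ 2 μ => ∫ z, φ z * f z ∂μ) = fun f => inner ℂ (hm.toLp _) f := by
    ext f
    rw [L2.inner_def]
    refine integral_congr_ae ?_
    filter_upwards [hm.coeFn_toLp] with z hz
    rw [hz]
    simp [mul_comm]
  rw [h]
  fun_prop

theorem continuous_integral_Lp {α : Type*} [MeasurableSpace α] {μ : Measure α}
    [IsFiniteMeasure μ] : Continuous fun f : Lp ℂ 2 μ => ∫ z, f z ∂μ := by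
  simpa using continuous_integral_mul_Lp (μ := μ) (φ := fun _ => 1) aestronglyMeasurable_const
    (c := 1) (by simp)

theorem integral_mul_polyL2 (μ : Measure (CSphere d)) [IsFiniteMeasure μ] (F : CSphere d → ℂ)
    (p : MvPolynomial (Fin d) ℂ) :
    ∫ z, F z * polyL2 μ p z ∂μ = ∫ z, F z * polyFun d p z ∂μ := by
  refine integral_congr_ae ?_
  filter_upwards [coeFn_polyL2 μ p] with z hz
  rw [hz]

theorem IsReinhardt.integral_polyFun {μ : Measure (CSphere d)} [IsFiniteMeasure μ]
    (hμ : IsReinhardt μ) (p : MvPolynomial (Fin d) ℂ) :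
    ∫ z, polyFun d p z ∂μ = μ.real Set.univ * MvPolynomial.constantCoeff p := by
  simpa using hμ.integral_mul_polyFun (F := fun _ => 1) (fun _ _ => rfl) (integrable_const _) p

theorem IsReinhardt.integral_polyL2 {μ : Measure (CSphere d)} [IsFiniteMeasure μ]
    (hμ : IsReinhardt μ) (p : MvPolynomial (Fin d) ℂ) :
    ∫ z, polyL2 μ p z ∂μ = μ.real Set.univ * MvPolynomial.constantCoeff p := by
  rw [← hμ.integral_polyFun, integral_congr_ae (coeFn_polyL2 μ p)]

theorem H2_induction {μ : Measure (CSphere d)} [IsFiniteMeasure μ] {E : Type*}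
    [TopologicalSpace E] [T2Space E] {a b : Lp ℂ 2 μ → E} (ha : Continuous a) (hb : Continuous b)
    (h : ∀ p, a (polyL2 μ p) = b (polyL2 μ p)) (f : H2 μ) : a f = b f := by
  refine closure_minimal (t := {f | a f = b f}) ?_ (isClosed_eq ha hb) f.2
  rintro _ ⟨p, rfl⟩
  exact h p

/-- By density this reduces to polynomials, where both integrals see only the constant term. The
total mass is multiplied through instead of divided out. -/
theorem IsReinhardt.integral_mul_H2 {μ : Measure (CSphere d)} [IsFiniteMeasure μ]
    (hμ : IsReinhardt μ) {F : CSphere d → ℂ} (hF : ∀ t z, F (rotate t z) = F z)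
    (hFm : AEStronglyMeasurable F μ) {c : ℝ} (hc : ∀ z, ‖F z‖ ≤ c) (f : H2 μ) :
    (∫ z, F z * (f : Lp ℂ 2 μ) z ∂μ) * μ.real Set.univ =
      (∫ z, F z ∂μ) * ∫ z, (f : Lp ℂ 2 μ) z ∂μ := by
  refine H2_induction
    (a := fun f : Lp ℂ 2 μ => (∫ z, F z * f z ∂μ) * μ.real Set.univ)
    (b := fun f : Lp ℂ 2 μ => (∫ z, F z ∂μ) * ∫ z, f z ∂μ)
    ((continuous_integral_mul_Lp hFm (Filter.Eventually.of_forall hc)).mul continuous_const)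
    (continuous_const.mul continuous_integral_Lp) (fun p => ?_) f
  have hFi : Integrable F μ := Integrable.of_bound hFm c (Filter.Eventually.of_forall hc)
  simp only [integral_mul_polyL2, hμ.integral_mul_polyFun hF hFi, hμ.integral_polyL2]
  ring

/-- For polynomials this is multiplicativity of the constant coefficient. It makes every product `(p
∘ u) g` have mean zero as soon as `g` does. -/
theorem IsReinhardt.integral_polyFun_mul_H2 {μ : Measure (CSphere d)} [IsFiniteMeasure μ]
    (hμ : IsReinhardt μ) (q : MvPolynomial (Fin d) ℂ) (f : H2 μ) :
    ∫ z, polyFun d q z * (f : Lp ℂ 2 μ) z ∂μ =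
      MvPolynomial.constantCoeff q * ∫ z, (f : Lp ℂ 2 μ) z ∂μ := by
  refine H2_induction
    (a := fun f : Lp ℂ 2 μ => ∫ z, polyFun d q z * f z ∂μ)
    (b := fun f : Lp ℂ 2 μ => MvPolynomial.constantCoeff q * ∫ z, f z ∂μ)
    (continuous_integral_mul_Lp (polyFun d q).continuous.aestronglyMeasurable
      (Filter.Eventually.of_forall fun z => (polyFun d q).norm_coe_le_norm z))
    (continuous_const.mul continuous_integral_Lp) (fun p => ?_) f
  have h := hμ.integral_polyFun (q * p)
  simp only [map_mul, ContinuousMap.mul_apply] at h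
  simp only [integral_mul_polyL2, h, hμ.integral_polyL2]
  ring

/-! ### Intertwiners give domination of the translated measures -/

theorem integrable_normSq_Lp {α : Type*} [MeasurableSpace α] {μ : Measure α} (f : Lp ℂ 2 μ) :
    Integrable (fun z => ‖f z‖ ^ 2) μ :=
  MemLp.integrable_norm_pow (p := 2) (Lp.memLp f) two_ne_zero

theorem measureReal_univ_ne_zero {α : Type*} [MeasurableSpace α] {μ : Measure α}
    [IsFiniteMeasure μ] (hμ0 : μ ≠ 0) : μ.real Set.univ ≠ 0 := by
  have : NeZero μ := ⟨hμ0⟩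
  exact (measureReal_univ_pos (μ := μ)).ne'

/-- The squared modulus of a function in `H²(μ)` dominates, on average over scalar rotations, the
squared modulus of its mean. -/
theorem IsReinhardt.normSq_mean_mul_integral_le {μ : Measure (CSphere d)} [IsFiniteMeasure μ]
    (hμ : IsReinhardt μ) (hμ0 : μ ≠ 0) (g : H2 μ) {F : CSphere d → ℝ} (hFm : Measurable F)
    (hF : ∀ t z, F (rotate t z) = F z) (hF0 : ∀ z, 0 ≤ F z) (hF1 : ∀ z, F z ≤ 1) :
    ‖(∫ z, (g : Lp ℂ 2 μ) z ∂μ) / μ.real Set.univ‖ ^ 2 * ∫ z, F z ∂μ ≤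
      ∫ z, F z * ‖(g : Lp ℂ 2 μ) z‖ ^ 2 ∂μ := by
  set c : ℂ := (∫ z, (g : Lp ℂ 2 μ) z ∂μ) / μ.real Set.univ with hc
  have hne : (μ.real Set.univ : ℂ) ≠ 0 := by exact_mod_cast measureReal_univ_ne_zero hμ0
  have hFn : ∀ z, ‖F z‖ ≤ 1 := fun z => by
    rw [Real.norm_of_nonneg (hF0 z)]
    exact hF1 z
  have hFi : Integrable F μ := Integrable.of_bound hFm.aestronglyMeasurable 1
    (Filter.Eventually.of_forall hFn)
  have hgi : Integrable (g : Lp ℂ 2 μ) μ := (Lp.memLp (g : Lp ℂ 2 μ)).integrable one_le_two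
  have hFg : Integrable (fun z => (F z : ℂ) * (g : Lp ℂ 2 μ) z) μ :=
    hgi.bdd_mul (c := 1) (Complex.measurable_ofReal.comp hFm).aestronglyMeasurable
      (Filter.Eventually.of_forall fun z => by simpa using hFn z)
  have hFgg : Integrable (fun z => F z * ‖(g : Lp ℂ 2 μ) z‖ ^ 2) μ :=
    (integrable_normSq_Lp _).bdd_mul (c := 1) hFm.aestronglyMeasurable
      (Filter.Eventually.of_forall hFn)
  have h1 : ∫ z, (F z : ℂ) * (g : Lp ℂ 2 μ) z ∂μ = c * ((∫ z, F z ∂μ : ℝ) : ℂ) := by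
    have := hμ.integral_mul_H2 (F := fun z => (F z : ℂ)) (fun t z => by rw [hF])
      (Complex.measurable_ofReal.comp hFm).aestronglyMeasurable (c := 1)
      (fun z => by simpa using hFn z) g
    rw [integral_complex_ofReal] at this
    rw [hc]
    field_simp
    rw [this]
    ring
  have hre : Integrable (fun z => ((starRingEnd ℂ) c * ((F z : ℂ) * (g : Lp ℂ 2 μ) z)).re) μ :=
    (hFg.const_mul _).re
  have h2 : ∫ z, 2 * ((starRingEnd ℂ) c * ((F z : ℂ) * (g : Lp ℂ 2 μ) z)).re - ‖c‖ ^ 2 * F z ∂μ =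
      ‖c‖ ^ 2 * ∫ z, F z ∂μ := by
    rw [integral_sub (hre.const_mul 2) (hFi.const_mul _), integral_const_mul,
      integral_const_mul]
    have h3 : ∫ z, ((starRingEnd ℂ) c * ((F z : ℂ) * (g : Lp ℂ 2 μ) z)).re ∂μ =
        ‖c‖ ^ 2 * ∫ z, F z ∂μ := by
      refine (integral_re (𝕜 := ℂ) (hFg.const_mul ((starRingEnd ℂ) c))).trans ?_
      rw [integral_const_mul, h1, ← mul_assoc, Complex.conj_mul', ← Complex.ofReal_pow,
        ← Complex.ofReal_mul]
      rfl
    rw [h3]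
    ring
  rw [← h2]
  refine integral_mono ((hre.const_mul 2).sub (hFi.const_mul _)) hFgg
    fun z => ?_
  -- The pointwise inequality is `F |g - c|² ≥ 0`, expanded.
  have h4 : ‖(g : Lp ℂ 2 μ) z - c‖ ^ 2 =
      ‖(g : Lp ℂ 2 μ) z‖ ^ 2 + ‖c‖ ^ 2 - 2 * ((starRingEnd ℂ) c * (g : Lp ℂ 2 μ) z).re := by
    rw [← Complex.normSq_eq_norm_sq, ← Complex.normSq_eq_norm_sq, ← Complex.normSq_eq_norm_sq,
      Complex.normSq_sub, mul_comm ((starRingEnd ℂ) c)]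
  have h5 : ((starRingEnd ℂ) c * ((F z : ℂ) * (g : Lp ℂ 2 μ) z)).re =
      F z * ((starRingEnd ℂ) c * (g : Lp ℂ 2 μ) z).re := by
    rw [mul_left_comm, Complex.re_ofReal_mul]
  have h6 := mul_nonneg (hF0 z) (sq_nonneg ‖(g : Lp ℂ 2 μ) z - c‖)
  rw [h4] at h6
  simp only [h5]
  linarith

/-- The average of the indicator function of `A` over scalar rotations. -/
noncomputable def rotationAverage (A : Set (CSphere d)) (z : CSphere d) : ℝ :=
  (volume : Measure UnitAddCircle).real {t | rotate t z ∈ A}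

theorem measurable_rotationAverage {A : Set (CSphere d)} (hA : MeasurableSet A) :
    Measurable (rotationAverage A) :=
  (measurable_measure_prodMk_right (μ := (volume : Measure UnitAddCircle))
    (continuous_rotate.measurable hA)).ennreal_toReal

theorem rotationAverage_rotate (A : Set (CSphere d)) (s : UnitAddCircle) (z : CSphere d) :
    rotationAverage A (rotate s z) = rotationAverage A z := by
  have h : {t | rotate t (rotate s z) ∈ A} = (fun t => t + s) ⁻¹' {t | rotate t z ∈ A} := by
    ext t
    simp [rotate_add]
  rw [rotationAverage, h, Measure.real, measure_preimage_add_right]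
  rfl

theorem rotationAverage_nonneg (A : Set (CSphere d)) (z : CSphere d) : 0 ≤ rotationAverage A z :=
  ENNReal.toReal_nonneg

theorem rotationAverage_le_one (A : Set (CSphere d)) (z : CSphere d) :
    rotationAverage A z ≤ 1 := by
  refine ENNReal.toReal_le_of_le_ofReal zero_le_one ?_
  rw [ENNReal.ofReal_one, ← UnitAddCircle.measure_univ]
  exact measure_mono (Set.subset_univ _)

/-- Scalar rotations are central in the unitary group. -/
theorem rotationAverage_unitaryAct (A : Set (CSphere d)) (u : Matrix.unitaryGroup (Fin d) ℂ)
    (z : CSphere d) : rotationAverage A (unitaryAct u z) = rotationAverage (unitaryAct u ⁻¹' A) z := by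
  simp only [rotationAverage, Set.mem_preimage, unitaryAct_rotate]

/-- Fubini: each rotation preserves `μ`, and the circle has total mass 1. -/
theorem IsReinhardt.integral_rotationAverage {μ : Measure (CSphere d)} [IsFiniteMeasure μ]
    (hμ : IsReinhardt μ) {A : Set (CSphere d)} (hA : MeasurableSet A) :
    ∫ z, rotationAverage A z ∂μ = μ.real A := by
  have hS : MeasurableSet ((fun x : UnitAddCircle × CSphere d => rotate x.1 x.2) ⁻¹' A) :=
    continuous_rotate.measurable hA
  refine (integral_toReal (measurable_measure_prodMk_right hS).aemeasurable
    (Filter.Eventually.of_forall fun z => measure_lt_top _ _)).trans ?_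
  refine congrArg ENNReal.toReal ?_
  rw [← Measure.prod_apply_symm hS, Measure.prod_apply hS]
  have h : ∀ t : UnitAddCircle, μ (Prod.mk t ⁻¹'
      ((fun x : UnitAddCircle × CSphere d => rotate x.1 x.2) ⁻¹' A)) = μ A := fun t =>
    (hμ.measurePreserving_rotate t).measure_preimage hA.nullMeasurableSet
  simp [h]

/-- The weight of an intertwiner dominates `μ`, up to the squared norm of the intertwiner. -/
theorem integral_comp_unitaryAct_mul_normSq_le {μ : Measure (CSphere d)} [IsFiniteMeasure μ]
    {u : Matrix.unitaryGroup (Fin d) ℂ} {Γ : H2 μ →L[ℂ] H2 μ}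
    (hΓ : ∀ j, Γ ∘L Mz μ j = unitaryActTuple u (Mz μ) j ∘L Γ) {φ : CSphere d → ℝ}
    (hφ : Measurable φ) (hφ0 : ∀ z, 0 ≤ φ z) (hφi : Integrable φ μ) :
    ∫ z, φ (unitaryAct u z) * ‖(Γ (polyH2 μ 1) : Lp ℂ 2 μ) z‖ ^ 2 ∂μ ≤
      ‖Γ‖ ^ 2 * ∫ z, φ z ∂μ := by
  have hΓp := coeFn_intertwiner_polyH2 hΓ
  generalize (Γ (polyH2 μ 1) : Lp ℂ 2 μ) = g at hΓp ⊢
  have hwm : AEMeasurable (fun z => ‖g z‖₊ ^ 2) μ :=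
    (Lp.aestronglyMeasurable g).nnnorm.aemeasurable.pow_const 2
  have hfin : IsFiniteMeasure (μ.withDensity fun z => ((‖g z‖₊ ^ 2 : NNReal) : ℝ≥0∞)) := by
    have := isFiniteMeasure_withDensity_ofReal (integrable_normSq_Lp g).hasFiniteIntegral
    convert this using 3 with z
    rw [ENNReal.ofReal_pow (norm_nonneg _), ofReal_norm]
    simp [enorm]
  have hνint : ∀ φ : CSphere d → ℝ, Measurable φ →
      ∫ z, φ z ∂((μ.withDensity fun z => ((‖g z‖₊ ^ 2 : NNReal) : ℝ≥0∞)).map (unitaryAct u)) =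
        ∫ z, φ (unitaryAct u z) * ‖g z‖ ^ 2 ∂μ := by
    intro φ hφ
    rw [integral_map (measurable_unitaryAct u).aemeasurable hφ.aestronglyMeasurable,
      integral_withDensity_eq_integral_smul₀ hwm]
    refine integral_congr_ae (Filter.Eventually.of_forall fun z => ?_)
    simp [NNReal.smul_def, mul_comm]
  -- Tested on `|p|²`, the claim is exactly `‖Γ p‖² ≤ ‖Γ‖² ‖p‖²`.
  have hνle : (μ.withDensity fun z => ((‖g z‖₊ ^ 2 : NNReal) : ℝ≥0∞)).map (unitaryAct u) ≤
      ENNReal.ofReal (‖Γ‖ ^ 2) • μ := by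
    refine measure_le_smul_of_forall_polyFun fun p => ?_
    rw [hνint _ (by fun_prop), ← norm_sq_polyL2]
    have h1 : ∫ z, ‖polyFun d p (unitaryAct u z)‖ ^ 2 * ‖g z‖ ^ 2 ∂μ =
        ‖Γ (polyH2 μ p)‖ ^ 2 := by
      rw [Submodule.coe_norm, norm_sq_eq_integral]
      refine integral_congr_ae ?_
      filter_upwards [hΓp p] with z hz
      rw [hz, norm_mul, mul_pow]
    rw [h1, ← mul_pow]
    exact pow_le_pow_left₀ (norm_nonneg _) (Γ.le_opNorm _) 2
  rw [← hνint φ hφ]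
  refine (integral_mono_measure hνle (Filter.Eventually.of_forall hφ0)
    (hφi.smul_measure ENNReal.ofReal_ne_top)).trans_eq ?_
  rw [integral_smul_measure, ENNReal.toReal_ofReal (by positivity), smul_eq_mul]

/-- The weight of an invertible intertwiner has nonzero mean. -/
theorem IsReinhardt.integral_intertwiner_one_ne_zero {μ : Measure (CSphere d)} [IsFiniteMeasure μ]
    (hμ0 : μ ≠ 0) (hμ : IsReinhardt μ) {u : Matrix.unitaryGroup (Fin d) ℂ} {Γ : H2 μ →L[ℂ] H2 μ}
    (hΓ : ∀ j, Γ ∘L Mz μ j = unitaryActTuple u (Mz μ) j ∘L Γ) (hsurj : Function.Surjective Γ) :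
    ∫ z, (Γ (polyH2 μ 1) : Lp ℂ 2 μ) z ∂μ ≠ 0 := by
  intro h0
  have h1 : ∀ f : H2 μ, ∫ z, (Γ f : Lp ℂ 2 μ) z ∂μ = 0 := by
    intro f
    refine (denseRange_polyH2 μ).induction_on
      (p := fun f : H2 μ => ∫ z, (Γ f : Lp ℂ 2 μ) z ∂μ = 0) f ?_ fun p => ?_
    · exact isClosed_eq (continuous_integral_Lp.comp (continuous_subtype_val.comp Γ.continuous))
        continuous_const
    · rw [integral_congr_ae (coeFn_intertwiner_polyH2 hΓ p)]
      have := hμ.integral_polyFun_mul_H2 (polySubst u p) (Γ (polyH2 μ 1))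
      simp only [polyFun_polySubst] at this
      rw [this, h0, mul_zero]
  -- The constant 1 would lie in the range of `Γ`, but its mean is not zero.
  obtain ⟨f, hf⟩ := hsurj (polyH2 μ 1)
  have h2 := h1 f
  rw [hf, coe_polyH2, hμ.integral_polyL2] at h2
  simp [measureReal_univ_ne_zero hμ0] at h2

theorem IsReinhardt.exists_map_unitaryAct_le {μ : Measure (CSphere d)} [IsFiniteMeasure μ]
    (hμ0 : μ ≠ 0) (hμ : IsReinhardt μ) {u : Matrix.unitaryGroup (Fin d) ℂ}
    (h : SimilarTuples (Mz μ) (unitaryActTuple u (Mz μ))) :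
    ∃ C : ℝ, μ.map (unitaryAct u) ≤ ENNReal.ofReal C • μ := by
  obtain ⟨X, hX⟩ := h
  have hg0 := hμ.integral_intertwiner_one_ne_zero hμ0 hX X.surjective
  have hle := fun A (hA : MeasurableSet A) => hμ.normSq_mean_mul_integral_le hμ0
    ((X : H2 μ →L[ℂ] H2 μ) (polyH2 μ 1)) (measurable_rotationAverage hA)
    (rotationAverage_rotate _) (rotationAverage_nonneg _) (rotationAverage_le_one _)
  have hdom := fun A (hA : MeasurableSet A) => integral_comp_unitaryAct_mul_normSq_le hX
    (measurable_rotationAverage hA) (rotationAverage_nonneg _)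
    (Integrable.of_bound (measurable_rotationAverage hA).aestronglyMeasurable 1
      (Filter.Eventually.of_forall fun z => by
        rw [Real.norm_of_nonneg (rotationAverage_nonneg A z)]
        exact rotationAverage_le_one A z))
  generalize (X : H2 μ →L[ℂ] H2 μ) (polyH2 μ 1) = g at hg0 hle hdom
  generalize ‖(X : H2 μ →L[ℂ] H2 μ)‖ = B at hdom
  have hcpos : 0 < ‖(∫ z, (g : Lp ℂ 2 μ) z ∂μ) / μ.real Set.univ‖ ^ 2 := by
    have : (∫ z, (g : Lp ℂ 2 μ) z ∂μ) / μ.real Set.univ ≠ 0 :=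
      div_ne_zero hg0 (by exact_mod_cast measureReal_univ_ne_zero hμ0)
    positivity
  generalize ‖(∫ z, (g : Lp ℂ 2 μ) z ∂μ) / μ.real Set.univ‖ ^ 2 = c at hcpos hle
  -- With `F` the rotation average of `u⁻¹A`: `c μ(u⁻¹A) ≤ ∫ F |g|² ≤ B² μ(A)`.
  refine ⟨B ^ 2 / c, Measure.le_iff.2 fun A hA => ?_⟩
  have h1 := hle _ (measurable_unitaryAct u hA)
  have h2 := hdom A hA
  simp only [rotationAverage_unitaryAct] at h2
  rw [hμ.integral_rotationAverage (measurable_unitaryAct u hA)] at h1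
  rw [hμ.integral_rotationAverage hA] at h2
  rw [Measure.map_apply (measurable_unitaryAct u) hA, Measure.smul_apply, smul_eq_mul,
    ← ofReal_measureReal, ← ofReal_measureReal (s := A), ← ENNReal.ofReal_mul (by positivity)]
  refine ENNReal.ofReal_le_ofReal ?_
  rw [div_mul_eq_mul_div, le_div_iff₀ hcpos]
  linarith

/-! ### Uniformity over the unitary group -/

instance : SecondCountableTopology (Matrix.unitaryGroup (Fin d) ℂ) := by
  have : SecondCountableTopology (Matrix (Fin d) (Fin d) ℂ) :=
    inferInstanceAs (SecondCountableTopology (Fin d → Fin d → ℂ))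
  exact TopologicalSpace.Subtype.secondCountableTopology _

instance : CompactSpace (Matrix.unitaryGroup (Fin d) ℂ) := by
  refine isCompact_iff_compactSpace (X := Matrix (Fin d) (Fin d) ℂ).1 ?_
  have hK : IsCompact (Set.univ.pi fun _ => Set.univ.pi fun _ => Metric.closedBall 0 1 :
      Set (Fin d → Fin d → ℂ)) :=
    isCompact_univ_pi fun _ => isCompact_univ_pi fun _ => isCompact_closedBall 0 1
  refine hK.of_isClosed_subset ?_ fun A hA => ?_
  · have h : (Matrix.unitaryGroup (Fin d) ℂ : Set (Matrix (Fin d) (Fin d) ℂ)) =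
        {A | A * star A = 1} := by
      ext A
      exact Matrix.mem_unitaryGroup_iff
    rw [h]
    exact isClosed_eq (by fun_prop) continuous_const
  · exact fun i _ j _ => by simpa using entry_norm_bound_of_unitary hA i j

/-- For a fixed test function the inequality is a closed condition on `u`, which domination of
measures does not show directly. -/
theorem map_unitaryAct_le_iff {μ : Measure (CSphere d)} [IsFiniteMeasure μ]
    (u : Matrix.unitaryGroup (Fin d) ℂ) {C : ℝ} (hC : 0 ≤ C) :
    μ.map (unitaryAct u) ≤ ENNReal.ofReal C • μ ↔
      ∀ f : C(CSphere d, ℝ), (∀ z, 0 ≤ f z) → ∫ z, f (unitaryAct u z) ∂μ ≤ C * ∫ z, f z ∂μ := by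
  have hmap : ∀ f : C(CSphere d, ℝ), ∫ z, f (unitaryAct u z) ∂μ =
      ∫ z, f z ∂(μ.map (unitaryAct u)) := fun f =>
    (integral_map (measurable_unitaryAct u).aemeasurable f.continuous.aestronglyMeasurable).symm
  refine ⟨fun h f hf => ?_, fun h => measure_le_smul_of_forall_integral_le fun f hf => ?_⟩
  · have hi : Integrable f μ :=
      f.continuous.integrable_of_hasCompactSupport (HasCompactSupport.of_compactSpace _)
    rw [hmap]
    refine (integral_mono_measure h (Filter.Eventually.of_forall hf)
      (hi.smul_measure ENNReal.ofReal_ne_top)).trans_eq ?_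
    rw [integral_smul_measure, ENNReal.toReal_ofReal hC, smul_eq_mul]
  · rw [← hmap]
    exact h f hf

theorem isClosed_setOf_map_unitaryAct_le (μ : Measure (CSphere d)) [IsFiniteMeasure μ] {C : ℝ}
    (hC : 0 ≤ C) : IsClosed {u : Matrix.unitaryGroup (Fin d) ℂ |
      μ.map (unitaryAct u) ≤ ENNReal.ofReal C • μ} := by
  simp only [map_unitaryAct_le_iff _ hC, Set.ofPred_forall]
  refine isClosed_iInter fun f => isClosed_iInter fun _ => isClosed_le ?_ continuous_const
  have h := continuous_parametric_integral_of_continuous (μ := μ)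
    (f := fun (u : Matrix.unitaryGroup (Fin d) ℂ) z => f (unitaryAct u z))
    (f.continuous.comp continuous_unitaryAct) isCompact_univ
  simpa using h

/-- If every unitary translate of `μ` is dominated by a multiple of `μ`, then the multiple can be
chosen independently of the unitary. -/
theorem exists_forall_map_unitaryAct_le {μ : Measure (CSphere d)} [IsFiniteMeasure μ]
    (h : ∀ u : Matrix.unitaryGroup (Fin d) ℂ, ∃ C : ℝ,
      μ.map (unitaryAct u) ≤ ENNReal.ofReal C • μ) :
    ∃ C : ℝ, 0 < C ∧ ∀ u : Matrix.unitaryGroup (Fin d) ℂ,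
      μ.map (unitaryAct u) ≤ ENNReal.ofReal C • μ := by
  choose C hC using h
  -- Baire: the closed sets with integer constant `n` exhaust the group, so one of them has
  -- interior, and finitely many of its translates cover the group.
  obtain ⟨n, hn⟩ := nonempty_interior_of_iUnion_of_closed
    (f := fun n : ℕ => {u : Matrix.unitaryGroup (Fin d) ℂ |
      μ.map (unitaryAct u) ≤ ENNReal.ofReal n • μ})
    (fun n => isClosed_setOf_map_unitaryAct_le μ n.cast_nonneg) (by
      refine Set.eq_univ_of_forall fun u => ?_
      obtain ⟨n, hn⟩ := exists_nat_ge (C u)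
      refine Set.mem_iUnion.2 ⟨n, (hC u).trans fun A => ?_⟩
      simp only [Measure.smul_apply, smul_eq_mul]
      gcongr)
  obtain ⟨t, ht⟩ := compact_covered_by_mul_left_translates isCompact_univ hn
  -- Writing `u = v⁻¹ (v u)` with `v u` in the set for `n` costs `n |C v⁻¹|`; the sum covers all `v
  -- ∈ t`, and 1 ensures positivity.
  refine ⟨∑ v ∈ t, n * |C v⁻¹| + 1, by positivity, fun u => ?_⟩
  obtain ⟨v, hv, hvu⟩ : ∃ v ∈ t, μ.map (unitaryAct (v * u)) ≤ ENNReal.ofReal n • μ := by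
    simpa using ht (Set.mem_univ u)
  have h1 : μ.map (unitaryAct u) = (μ.map (unitaryAct (v * u))).map (unitaryAct v⁻¹) := by
    rw [← map_unitaryAct_mul, inv_mul_cancel_left]
  rw [h1]
  refine (Measure.map_mono hvu (measurable_unitaryAct _)).trans fun A => ?_
  rw [Measure.map_smul, Measure.smul_apply, Measure.smul_apply, smul_eq_mul, smul_eq_mul]
  have h2 := hC v⁻¹ A
  rw [Measure.smul_apply, smul_eq_mul] at h2
  calc ENNReal.ofReal n * μ.map (unitaryAct v⁻¹) A
      ≤ ENNReal.ofReal n * (ENNReal.ofReal |C v⁻¹| * μ A) := by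
        refine mul_le_mul_right (h2.trans ?_) _
        gcongr
        exact le_abs_self _
    _ = ENNReal.ofReal (n * |C v⁻¹|) * μ A := by
        rw [← mul_assoc, ENNReal.ofReal_mul n.cast_nonneg]
    _ ≤ _ := by
        gcongr
        have := Finset.single_le_sum (f := fun v => n * |C v⁻¹|) (fun v _ => by positivity) hv
        linarith

/-! ### Domination of measures and bounds on the Radon–Nikodym derivative. -/

theorem rnDeriv_le_of_le_smul {α : Type*} [MeasurableSpace α] {μ ν : Measure α}
    [IsFiniteMeasure μ] [IsFiniteMeasure ν] {c : ℝ≥0∞} (h : ν ≤ c • μ) :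
    ∀ᵐ z ∂μ, ν.rnDeriv μ z ≤ c := by
  refine ae_le_of_forall_setLIntegral_le_of_sigmaFinite (Measure.measurable_rnDeriv _ _)
    fun s _ _ => (Measure.setLIntegral_rnDeriv_le s).trans ?_
  rw [setLIntegral_const]
  exact h s

theorem le_rnDeriv_of_smul_le {α : Type*} [MeasurableSpace α] {μ ν : Measure α}
    [IsFiniteMeasure μ] [IsFiniteMeasure ν] {c : ℝ≥0∞} (hac : ν ≪ μ) (h : c • μ ≤ ν) :
    ∀ᵐ z ∂μ, c ≤ ν.rnDeriv μ z := by
  refine ae_le_of_forall_setLIntegral_le_of_sigmaFinite measurable_const fun s _ _ => ?_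
  rw [Measure.setLIntegral_rnDeriv hac, setLIntegral_const]
  exact h s

theorem le_smul_of_rnDeriv_le {α : Type*} [MeasurableSpace α] {μ ν : Measure α}
    [IsFiniteMeasure μ] [IsFiniteMeasure ν] {c : ℝ≥0∞} (hac : ν ≪ μ)
    (h : ∀ᵐ z ∂μ, ν.rnDeriv μ z ≤ c) : ν ≤ c • μ := by
  intro s
  rw [← Measure.setLIntegral_rnDeriv hac, Measure.smul_apply, smul_eq_mul, ← setLIntegral_const]
  exact lintegral_mono_ae (ae_restrict_of_ae h)

theorem smul_le_of_le_rnDeriv {α : Type*} [MeasurableSpace α] {μ ν : Measure α}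
    [IsFiniteMeasure μ] [IsFiniteMeasure ν] {c : ℝ≥0∞}
    (h : ∀ᵐ z ∂μ, c ≤ ν.rnDeriv μ z) : c • μ ≤ ν := by
  intro s
  refine le_trans ?_ (Measure.setLIntegral_rnDeriv_le (ν := μ) s)
  rw [Measure.smul_apply, smul_eq_mul, ← setLIntegral_const]
  exact lintegral_mono_ae (ae_restrict_of_ae h)

theorem map_unitaryAct_rnDeriv_bounds {μ : Measure (CSphere d)} [IsFiniteMeasure μ] {C : ℝ}
    (hC : 0 < C) (h : ∀ u : Matrix.unitaryGroup (Fin d) ℂ,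
      μ.map (unitaryAct u) ≤ ENNReal.ofReal C • μ) (u : Matrix.unitaryGroup (Fin d) ℂ) :
    μ.map (unitaryAct u) ≪ μ ∧
      ∀ᵐ z ∂μ, ENNReal.ofReal C⁻¹ ≤ (μ.map (unitaryAct u)).rnDeriv μ z ∧
        (μ.map (unitaryAct u)).rnDeriv μ z ≤ ENNReal.ofReal C := by
  have hac : μ.map (unitaryAct u) ≪ μ := Measure.absolutelyContinuous_of_le_smul (h u)
  -- The lower bound is the upper bound for `u⁻¹`, pushed forward by `u`.
  have hlow : μ ≤ ENNReal.ofReal C • μ.map (unitaryAct u) := by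
    have h1 := Measure.map_mono (h u⁻¹) (measurable_unitaryAct u)
    rwa [← map_unitaryAct_mul, mul_inv_cancel, map_unitaryAct_one, Measure.map_smul] at h1
  refine ⟨hac, (le_rnDeriv_of_smul_le hac fun s => ?_).and (rnDeriv_le_of_le_smul (h u))⟩
  have h1 := hlow s
  rw [Measure.smul_apply, smul_eq_mul] at h1 ⊢
  rw [ENNReal.ofReal_inv_of_pos hC, mul_comm, ← div_eq_mul_inv]
  exact ENNReal.div_le_of_le_mul' h1

/-! ### The surface measure -/

/-- A unitary matrix as a real-linear isometry of `ℂ^d`. -/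
noncomputable def unitaryIsometry (u : Matrix.unitaryGroup (Fin d) ℂ) :
    EuclideanSpace ℂ (Fin d) ≃ₗᵢ[ℝ] EuclideanSpace ℂ (Fin d) where
  toFun z := WithLp.toLp 2 (Matrix.mulVec (u : Matrix (Fin d) (Fin d) ℂ) z.ofLp)
  invFun z := WithLp.toLp 2 (Matrix.mulVec ((u⁻¹ : Matrix.unitaryGroup (Fin d) ℂ) :
    Matrix (Fin d) (Fin d) ℂ) z.ofLp)
  map_add' z w := by simp [Matrix.mulVec_add]
  map_smul' c z := by simp [Matrix.mulVec_smul]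
  left_inv z := by
    simp only [Matrix.mulVec_mulVec, ← Submonoid.coe_mul]
    simp
  right_inv z := by
    simp only [Matrix.mulVec_mulVec, ← Submonoid.coe_mul]
    simp
  norm_map' z := norm_toLp_unitary_mulVec u z

theorem coe_unitaryAct (u : Matrix.unitaryGroup (Fin d) ℂ) (z : CSphere d) :
    (unitaryAct u z : EuclideanSpace ℂ (Fin d)) = unitaryIsometry u z := rfl

-- The sphere measure of `A` is a multiple of the volume of the cone over `A`. Linearity of `u`
-- carries cones to cones, and isometries preserve volume.
open scoped Pointwise in
theorem map_unitaryAct_toSphere (u : Matrix.unitaryGroup (Fin d) ℂ) :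
    (volume : Measure (EuclideanSpace ℂ (Fin d))).toSphere.map (unitaryAct u) =
      (volume : Measure (EuclideanSpace ℂ (Fin d))).toSphere := by
  ext A hA
  rw [Measure.map_apply (measurable_unitaryAct u) hA,
    Measure.toSphere_apply' _ (measurable_unitaryAct u hA), Measure.toSphere_apply' _ hA]
  congr 1
  have h : Set.Ioo (0 : ℝ) 1 • ((↑) '' (unitaryAct u ⁻¹' A) : Set (EuclideanSpace ℂ (Fin d))) =
      unitaryIsometry u ⁻¹' (Set.Ioo (0 : ℝ) 1 • ((↑) '' A)) := by
    ext x
    simp only [Set.mem_smul, Set.mem_image, Set.mem_preimage]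
    constructor
    · rintro ⟨r, hr, _, ⟨z, hz, rfl⟩, rfl⟩
      exact ⟨r, hr, _, ⟨_, hz, rfl⟩, by rw [coe_unitaryAct, map_smul]⟩
    · rintro ⟨r, hr, _, ⟨z, hz, rfl⟩, hx⟩
      have hz' : unitaryAct u (unitaryAct u⁻¹ z) = z := by
        rw [← unitaryAct_mul, mul_inv_cancel, unitaryAct_one]
      refine ⟨r, hr, _, ⟨unitaryAct u⁻¹ z, by rwa [hz'], rfl⟩, ?_⟩
      apply (unitaryIsometry u).injective
      rw [← hx, map_smul, ← coe_unitaryAct, hz']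
  rw [h]
  exact (unitaryIsometry u).measurePreserving.measure_preimage_equiv
    (f := (unitaryIsometry u).toHomeomorph.toMeasurableEquiv) _

theorem map_unitaryAct_surfaceMeasure (u : Matrix.unitaryGroup (Fin d) ℂ) :
    (surfaceMeasure d).map (unitaryAct u) = surfaceMeasure d := by
  rw [surfaceMeasure, ProbabilityTheory.cond, Measure.restrict_univ, Measure.map_smul,
    map_unitaryAct_toSphere]

/-- The index `i` witnesses `d ≥ 1`; for `d = 0` the sphere is empty. -/
theorem surfaceMeasure_univ (i : Fin d) : surfaceMeasure d Set.univ = 1 := by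
  have : Nontrivial (EuclideanSpace ℂ (Fin d)) :=
    ⟨⟨0, EuclideanSpace.single i 1, fun h => by
      simpa using congrArg (fun x : EuclideanSpace ℂ (Fin d) => x i) h⟩⟩
  have h : IsProbabilityMeasure (surfaceMeasure d) :=
    ProbabilityTheory.cond_isProbabilityMeasure
      (mt Measure.measure_univ_eq_zero.1 (Measure.toSphere_ne_zero _))
  exact h.measure_univ

/-! ### Transitivity and averaging over the unitary group -/

/-- Extend `z`, placed at index `i`, to an orthonormal basis; the matrix with these columns is
unitary. -/
theorem exists_unitaryAct_single (i : Fin d) (e z : CSphere d)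
    (he : (e : EuclideanSpace ℂ (Fin d)) = EuclideanSpace.single i 1) :
    ∃ u : Matrix.unitaryGroup (Fin d) ℂ, unitaryAct u e = z := by
  have hz : Orthonormal ℂ (({i} : Set (Fin d)).domRestrict fun _ => z.1) := by
    refine ⟨fun _ => mem_sphere_zero_iff_norm.1 z.2, fun a b hab => ?_⟩
    exact absurd (Subsingleton.elim a b) hab
  obtain ⟨b, hb⟩ := hz.exists_orthonormalBasis_extension_of_card_eq (by simp)
  refine ⟨⟨(EuclideanSpace.basisFun (Fin d) ℂ).toBasis.toMatrix b,
    (EuclideanSpace.basisFun (Fin d) ℂ).toMatrix_orthonormalBasis_mem_unitary b⟩, ?_⟩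
  refine Subtype.ext (PiLp.ext fun j => ?_)
  rw [unitaryAct_apply, he, Finset.sum_eq_single i]
  · simp [Module.Basis.toMatrix_apply, hb i rfl]
  · intro k _ hk
    simp [hk]
  · simp

theorem nonempty_of_cSphere (z : CSphere d) : Nonempty (Fin d) := by
  by_contra h
  rw [not_nonempty_iff] at h
  have h1 := mem_sphere_zero_iff_norm.1 z.2
  rw [Subsingleton.elim z.1 0, norm_zero] at h1
  exact zero_ne_one h1

theorem exists_unitaryAct_eq (z w : CSphere d) :
    ∃ u : Matrix.unitaryGroup (Fin d) ℂ, unitaryAct u z = w := by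
  obtain ⟨i⟩ := nonempty_of_cSphere z
  let e : CSphere d := ⟨EuclideanSpace.single i 1, by simp⟩
  obtain ⟨u, hu⟩ := exists_unitaryAct_single i e z rfl
  obtain ⟨v, hv⟩ := exists_unitaryAct_single i e w rfl
  exact ⟨v * u⁻¹, by rw [unitaryAct_mul, ← hu, unitaryAct_inv_unitaryAct, hv]⟩

/-- Averaging a finite measure over the unitary group gives a multiple of the surface measure. -/
theorem lintegral_map_unitaryAct_inv [MeasurableSpace (Matrix.unitaryGroup (Fin d) ℂ)]
    [BorelSpace (Matrix.unitaryGroup (Fin d) ℂ)] (η : Measure (Matrix.unitaryGroup (Fin d) ℂ))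
    [IsProbabilityMeasure η] [η.IsMulLeftInvariant] (μ : Measure (CSphere d)) [IsFiniteMeasure μ]
    {A : Set (CSphere d)} (hA : MeasurableSet A) :
    ∫⁻ u, μ.map (unitaryAct u⁻¹) A ∂η = μ Set.univ * surfaceMeasure d A := by
  rcases isEmpty_or_nonempty (CSphere d) with hE | ⟨⟨e⟩⟩
  · simp [Measure.eq_zero_of_isEmpty μ]
  have hS : MeasurableSet ((fun x : Matrix.unitaryGroup (Fin d) ℂ × CSphere d =>
      unitaryAct x.1⁻¹ x.2) ⁻¹' A) := by
    have hc : Continuous fun x : Matrix.unitaryGroup (Fin d) ℂ × CSphere d =>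
        unitaryAct x.1⁻¹ x.2 :=
      continuous_unitaryAct.comp ((continuous_inv.comp continuous_fst).prodMk continuous_snd)
    exact hc.measurable hA
  -- For `z = v e` one has `u⁻¹ z = (v⁻¹ u)⁻¹ e`, so left invariance suffices; this is why the
  -- average runs over `u⁻¹`.
  have hconst : ∀ z : CSphere d, η {u | unitaryAct u⁻¹ z ∈ A} = η {u | unitaryAct u⁻¹ e ∈ A} := by
    intro z
    obtain ⟨v, rfl⟩ := exists_unitaryAct_eq e z
    rw [← measure_preimage_mul η v⁻¹ {u | unitaryAct u⁻¹ e ∈ A}]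
    congr 1
    ext u
    simp [unitaryAct_mul]
  have key : ∀ (ν : Measure (CSphere d)) [IsFiniteMeasure ν],
      ∫⁻ u, ν.map (unitaryAct u⁻¹) A ∂η = η {u | unitaryAct u⁻¹ e ∈ A} * ν Set.univ := by
    intro ν _
    have h1 : ∀ u : Matrix.unitaryGroup (Fin d) ℂ, ν.map (unitaryAct u⁻¹) A =
        ν (Prod.mk u ⁻¹' ((fun x : Matrix.unitaryGroup (Fin d) ℂ × CSphere d =>
          unitaryAct x.1⁻¹ x.2) ⁻¹' A)) := fun u => Measure.map_apply (measurable_unitaryAct _) hA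
    simp only [h1]
    rw [← Measure.prod_apply hS, Measure.prod_apply_symm hS]
    refine (lintegral_congr hconst).trans ?_
    rw [lintegral_const]
  obtain ⟨i⟩ := nonempty_of_cSphere e
  -- The invariant measure `σ` of mass 1 identifies the unknown constant `η {u | u⁻¹ e ∈ A}` as
  -- `σ(A)`.
  have h2 := key (surfaceMeasure d)
  simp only [map_unitaryAct_surfaceMeasure, surfaceMeasure_univ i, lintegral_const,
    measure_univ, mul_one] at h2
  rw [key μ, h2, mul_comm]

/-- A measure that is comparable to its unitary translates, uniformly, is comparable to the surface
measure. -/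
theorem smul_le_surfaceMeasure_and_le {μ : Measure (CSphere d)} [IsFiniteMeasure μ] {a b : ℝ≥0∞}
    (ha : ∀ u : Matrix.unitaryGroup (Fin d) ℂ, a • μ ≤ μ.map (unitaryAct u))
    (hb : ∀ u : Matrix.unitaryGroup (Fin d) ℂ, μ.map (unitaryAct u) ≤ b • μ) :
    a • μ ≤ μ Set.univ • surfaceMeasure d ∧ μ Set.univ • surfaceMeasure d ≤ b • μ := by
  let _ : MeasurableSpace (Matrix.unitaryGroup (Fin d) ℂ) := borel _
  have : BorelSpace (Matrix.unitaryGroup (Fin d) ℂ) := ⟨rfl⟩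
  let η : Measure (Matrix.unitaryGroup (Fin d) ℂ) := Measure.haarMeasure ⊤
  have : IsProbabilityMeasure η := ⟨Measure.haarMeasure_self (K₀ := ⊤)⟩
  refine ⟨Measure.le_iff.2 fun A hA => ?_, Measure.le_iff.2 fun A hA => ?_⟩
  · rw [Measure.smul_apply (μ Set.univ), smul_eq_mul, ← lintegral_map_unitaryAct_inv η μ hA]
    calc (a • μ) A = ∫⁻ _, (a • μ) A ∂η := by simp
      _ ≤ _ := lintegral_mono fun u => ha u⁻¹ A
  · rw [Measure.smul_apply (μ Set.univ), smul_eq_mul, ← lintegral_map_unitaryAct_inv η μ hA]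
    calc _ ≤ ∫⁻ _, (b • μ) A ∂η := lintegral_mono fun u => hb u⁻¹ A
      _ = _ := by simp

/-! ### Similarities -/

theorem exists_norm_polyH2_le {μ ν : Measure (CSphere d)} [IsFiniteMeasure μ] [IsFiniteMeasure ν]
    {c : ℝ≥0∞} (hc : c ≠ ∞) (h : ν ≤ c • μ) : ∃ C, ∀ p, ‖polyH2 ν p‖ ≤ C * ‖polyH2 μ p‖ := by
  refine ⟨Real.sqrt c.toReal, fun p => ?_⟩
  rw [← abs_of_nonneg (norm_nonneg (polyH2 ν p)), ← Real.sqrt_sq_eq_abs,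
    ← Real.sqrt_sq (norm_nonneg (polyH2 μ p)), ← Real.sqrt_mul ENNReal.toReal_nonneg]
  refine Real.sqrt_le_sqrt ?_
  rw [Submodule.coe_norm, Submodule.coe_norm, coe_polyH2, coe_polyH2, norm_sq_polyL2,
    norm_sq_polyL2]
  have hi : Integrable (fun z => ‖polyFun d p z‖ ^ 2) μ :=
    Continuous.integrable_of_hasCompactSupport (by fun_prop) (HasCompactSupport.of_compactSpace _)
  refine (integral_mono_measure h (Filter.Eventually.of_forall fun _ => sq_nonneg _)
    (hi.smul_measure hc)).trans_eq ?_
  rw [integral_smul_measure, smul_eq_mul]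

theorem clm_ext_polyH2 {μ : Measure (CSphere d)} [IsFiniteMeasure μ] {E : Type*}
    [NormedAddCommGroup E] [NormedSpace ℂ E] {S T : H2 μ →L[ℂ] E}
    (h : ∀ p, S (polyH2 μ p) = T (polyH2 μ p)) : S = T :=
  ContinuousLinearMap.ext fun f => (denseRange_polyH2 μ).induction_on f
    (isClosed_eq S.continuous T.continuous) h

theorem commute_Mz (μ : Measure (CSphere d)) [IsFiniteMeasure μ] (i j : Fin d) :
    Commute (Mz μ i) (Mz μ j) := by
  refine clm_ext_polyH2 fun p => ?_
  simp only [mul_apply_eq_comp, Mz_polyH2]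
  rw [mul_left_comm]

instance (μ : Measure (CSphere d)) [IsFiniteMeasure μ] : CompleteSpace (H2 μ) :=
  (Submodule.isClosed_topologicalClosure _).completeSpace_coe

/-- A linear bijection of the polynomials that is bounded in both directions extends to `H²`. -/
theorem exists_equiv_polyH2 {μ ν : Measure (CSphere d)} [IsFiniteMeasure μ] [IsFiniteMeasure ν]
    (e : MvPolynomial (Fin d) ℂ ≃ₗ[ℂ] MvPolynomial (Fin d) ℂ)
    (h₁ : ∃ C, ∀ p, ‖polyH2 ν (e p)‖ ≤ C * ‖polyH2 μ p‖)
    (h₂ : ∃ C, ∀ p, ‖polyH2 μ (e.symm p)‖ ≤ C * ‖polyH2 ν p‖) :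
    ∃ X : H2 μ ≃L[ℂ] H2 ν, ∀ p, X (polyH2 μ p) = polyH2 ν (e p) :=
  ⟨e.extend (polyH2 μ) (polyH2 ν) (denseRange_polyH2 μ) h₁ (denseRange_polyH2 ν) h₂,
    LinearEquiv.extend_eq _ _ _ _ _ _ _⟩

/-- Comparable measures have similar multiplication tuples. -/
theorem similarTuples_Mz_of_le {μ ν : Measure (CSphere d)} [IsFiniteMeasure μ] [IsFiniteMeasure ν]
    {b c : ℝ≥0∞} (hb : b ≠ ∞) (hc : c ≠ ∞) (h1 : μ ≤ b • ν) (h2 : ν ≤ c • μ) :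
    SimilarTuples (Mz μ) (Mz ν) := by
  obtain ⟨X, hX⟩ := exists_equiv_polyH2 (LinearEquiv.refl ℂ _) (exists_norm_polyH2_le hc h2)
    (exists_norm_polyH2_le hb h1)
  refine ⟨X, fun j => clm_ext_polyH2 fun p => ?_⟩
  simp only [ContinuousLinearMap.comp_apply, ContinuousLinearEquiv.coe_coe, Mz_polyH2, hX,
    LinearEquiv.refl_apply]

/-- The change of variables by a unitary matrix as an equivalence of the polynomial ring. -/
noncomputable def polySubstEquiv (u : Matrix.unitaryGroup (Fin d) ℂ) :
    MvPolynomial (Fin d) ℂ ≃ₐ[ℂ] MvPolynomial (Fin d) ℂ :=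
  -- Substitution reverses composition: `p(v z)` evaluated at `w z` is `p(v w z)`.
  have h : ∀ v w : Matrix.unitaryGroup (Fin d) ℂ, v * w = 1 →
      (polySubst w).comp (polySubst v) = AlgHom.id ℂ _ := by
    intro v w hvw
    refine MvPolynomial.algHom_ext fun j => ?_
    have hjl : ∀ l, ∑ k, (v : Matrix (Fin d) (Fin d) ℂ) j k * (w : Matrix (Fin d) (Fin d) ℂ) k l =
        (1 : Matrix (Fin d) (Fin d) ℂ) j l := fun l => by
      rw [← Matrix.mul_apply, ← Submonoid.coe_mul, hvw]
      rfl
    simp only [AlgHom.comp_apply, polySubst, MvPolynomial.aeval_X, map_sum, map_mul,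
      MvPolynomial.aeval_C, MvPolynomial.algebraMap_eq, Finset.mul_sum, AlgHom.id_apply]
    rw [Finset.sum_comm]
    simp only [← mul_assoc, ← map_mul, ← Finset.sum_mul, ← map_sum, hjl, Matrix.one_apply]
    simp
  AlgEquiv.ofAlgHom (polySubst u) (polySubst u⁻¹) (h _ _ (inv_mul_cancel u))
    (h _ _ (mul_inv_cancel u))

/-- Invariance makes `p ↦ p ∘ u` isometric on polynomials. It intertwines because it is
multiplicative and sends `X_j` to `∑ₖ u_{jk} X_k`. -/
theorem similarTuples_unitaryActTuple_of_map_eq {μ : Measure (CSphere d)} [IsFiniteMeasure μ]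
    (hμ : ∀ u : Matrix.unitaryGroup (Fin d) ℂ, μ.map (unitaryAct u) = μ)
    (u : Matrix.unitaryGroup (Fin d) ℂ) :
    SimilarTuples (Mz μ) (unitaryActTuple u (Mz μ)) := by
  have hnorm : ∀ (v : Matrix.unitaryGroup (Fin d) ℂ) p, ‖polyH2 μ (polySubst v p)‖ =
      ‖polyH2 μ p‖ := by
    intro v p
    refine (sq_eq_sq₀ (norm_nonneg _) (norm_nonneg _)).1 ?_
    rw [Submodule.coe_norm, Submodule.coe_norm, coe_polyH2, coe_polyH2, norm_sq_polyL2,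
      norm_sq_polyL2]
    simp only [polyFun_polySubst]
    nth_rw 2 [← hμ v]
    rw [integral_map (measurable_unitaryAct v).aemeasurable
      (Continuous.aestronglyMeasurable (by fun_prop))]
  obtain ⟨X, hX⟩ := exists_equiv_polyH2 (μ := μ) (ν := μ) (polySubstEquiv u).toLinearEquiv
    ⟨1, fun p => by rw [one_mul]; exact (hnorm u p).le⟩
    ⟨1, fun p => by rw [one_mul]; exact (hnorm u⁻¹ p).le⟩
  have hX' : ∀ p, X (polyH2 μ p) = polyH2 μ (polySubst u p) := hX
  refine ⟨X, fun j => clm_ext_polyH2 fun p => ?_⟩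
  simp only [ContinuousLinearMap.comp_apply, ContinuousLinearEquiv.coe_coe, Mz_polyH2, hX',
    unitaryActTuple_Mz_polyH2, map_mul]

section Similar

variable {H K L : Type*} [NormedAddCommGroup H] [NormedSpace ℂ H] [NormedAddCommGroup K]
  [NormedSpace ℂ K] [NormedAddCommGroup L] [NormedSpace ℂ L]

theorem SimilarTuples.symm {T : Fin d → H →L[ℂ] H} {S : Fin d → K →L[ℂ] K}
    (h : SimilarTuples T S) : SimilarTuples S T := by
  obtain ⟨X, hX⟩ := h
  refine ⟨X.symm, fun j => ContinuousLinearMap.ext fun f => X.injective ?_⟩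
  have := DFunLike.congr_fun (hX j) (X.symm f)
  simp only [ContinuousLinearMap.comp_apply, ContinuousLinearEquiv.coe_coe,
    ContinuousLinearEquiv.apply_symm_apply] at this ⊢
  exact this.symm

theorem SimilarTuples.trans {T : Fin d → H →L[ℂ] H} {S : Fin d → K →L[ℂ] K}
    {R : Fin d → L →L[ℂ] L} (h : SimilarTuples T S) (h' : SimilarTuples S R) :
    SimilarTuples T R := by
  obtain ⟨X, hX⟩ := h
  obtain ⟨Y, hY⟩ := h'
  refine ⟨X.trans Y, fun j => ContinuousLinearMap.ext fun f => ?_⟩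
  have h1 := DFunLike.congr_fun (hX j) f
  have h2 := DFunLike.congr_fun (hY j) (X f)
  simp only [ContinuousLinearMap.comp_apply, ContinuousLinearEquiv.coe_coe,
    ContinuousLinearEquiv.trans_apply] at h1 h2 ⊢
  rw [h1, h2]

theorem SimilarTuples.unitaryActTuple {T : Fin d → H →L[ℂ] H} {S : Fin d → K →L[ℂ] K}
    (h : SimilarTuples T S) (u : Matrix.unitaryGroup (Fin d) ℂ) :
    SimilarTuples (unitaryActTuple u T) (unitaryActTuple u S) := by
  obtain ⟨X, hX⟩ := h
  refine ⟨X, fun j => ContinuousLinearMap.ext fun f => ?_⟩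
  have h1 := fun k => DFunLike.congr_fun (hX k) f
  simp only [ContinuousLinearMap.comp_apply, ContinuousLinearEquiv.coe_coe] at h1
  simp [SphereShift.unitaryActTuple, h1]

end Similar

end SphereShift

theorem theorem4p2 {d : ℕ} (μ : Measure (SphereShift.CSphere d)) [IsFiniteMeasure μ]
    (hμ0 : μ ≠ 0) (hμ : SphereShift.IsReinhardt μ) :
    List.TFAE [
      SphereShift.IsWeaklyUnitaryHomogeneous (SphereShift.Mz μ),
      ∃ k K : ℝ, 0 < k ∧ 0 < K ∧ ∀ u : Matrix.unitaryGroup (Fin d) ℂ,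
        μ.map (SphereShift.unitaryAct u) ≪ μ ∧
        ∀ᵐ z ∂μ, ENNReal.ofReal k ≤ (μ.map (SphereShift.unitaryAct u)).rnDeriv μ z ∧
          (μ.map (SphereShift.unitaryAct u)).rnDeriv μ z ≤ ENNReal.ofReal K,
      SphereShift.SimilarTuples (SphereShift.Mz μ) (SphereShift.szegoShift d)] := by
  open SphereShift in
  tfae_have 1 → 2 := by
    rintro ⟨-, h⟩
    obtain ⟨C, hC, hle⟩ := exists_forall_map_unitaryAct_le fun u =>
      hμ.exists_map_unitaryAct_le hμ0 (h u)
    exact ⟨C⁻¹, C, inv_pos.2 hC, hC, map_unitaryAct_rnDeriv_bounds hC hle⟩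
  tfae_have 2 → 3 := by
    rintro ⟨k, K, hk, hK, h⟩
    obtain ⟨h1, h2⟩ := smul_le_surfaceMeasure_and_le
      (fun u => smul_le_of_le_rnDeriv ((h u).2.mono fun z hz => hz.1))
      (fun u => le_smul_of_rnDeriv_le (h u).1 ((h u).2.mono fun z hz => hz.2))
    have hk0 : ENNReal.ofReal k ≠ 0 := (ENNReal.ofReal_pos.2 hk).ne'
    have hm0 : μ Set.univ ≠ 0 := mt Measure.measure_univ_eq_zero.1 hμ0
    -- With `m` the total mass of `μ`, the constants solve `k μ ≤ m σ ≤ K μ` for `μ` and for `σ`.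
    refine similarTuples_Mz_of_le (b := (ENNReal.ofReal k)⁻¹ * μ Set.univ)
      (c := (μ Set.univ)⁻¹ * ENNReal.ofReal K)
      (ENNReal.mul_ne_top (ENNReal.inv_ne_top.2 hk0) (measure_ne_top _ _))
      (ENNReal.mul_ne_top (ENNReal.inv_ne_top.2 hm0) ENNReal.ofReal_ne_top) (fun A => ?_)
      (fun A => ?_)
    · have := h1 A
      simp only [Measure.smul_apply, smul_eq_mul] at this ⊢
      rwa [mul_assoc, ← ENNReal.mul_le_iff_le_inv hk0 ENNReal.ofReal_ne_top]
    · have := h2 A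
      simp only [Measure.smul_apply, smul_eq_mul] at this ⊢
      rwa [mul_assoc, ← ENNReal.mul_le_iff_le_inv hm0 (measure_ne_top _ _)]
  -- The chain is `M_z(μ) ∼ M_z(σ) ∼ u · M_z(σ) ∼ u · M_z(μ)`.
  tfae_have 3 → 1 := fun h =>
    ⟨commute_Mz μ, fun u => (h.trans (similarTuples_unitaryActTuple_of_map_eq
      map_unitaryAct_surfaceMeasure u)).trans (h.unitaryActTuple u).symm⟩
  tfae_finish
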